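/- Let $d\ge 1$, let $K\subset\mathbb R^d$ be a full-dimensional simple polytope (a convex polytope with non-empty interior, each vertex of which lies on exactly $d$ facets), and let $(X_1,Y_1),\dots,(X_n,Y_n),(X,Y)$ be i.i.d. with values in $\mathbb R^d\times\{0,1\}$, where the marginal distribution $\mu$ of $X$ is the uniform distribution on $K$. Let $\eta(x)=\mathbb P(Y=1\mid X=x)$, let $f^*(x)=\mathbf 1\{\eta(x)>1/2\}$ be the Bayes classifier, and let $R(f)=\mathbb P(f(X)\ne Y)$ denote the zero-one risk. Given points $x_1,\dots,x_n$ that affinely span $\mathbb R^d$, let $T$ be a Delaunay triangulation of them: a subdivision of their convex hull $\widehat C$ into non-degenerate simplices with vertices among the $x_i$, any two of which intersect in their common face, such that the Voronoi cells of the vertices of each simplex have a common point (that is, no $x_i$ lies in the open circumscribed ball of a simplex). The triangulation depends on the $x_i$ only, not on the labels. The simplicial interpolant $\hat\eta$ of $(x_1,y_1),\dots,(x_n,y_n)$ is, on each simplex of $T$, the affine function that takes the values $y_i$ at the vertices $x_i$ of the simplex, and $\hat\eta(x)=1/2$ for $x\notin\widehat C$. Let $\hat f(x)=\mathbf 1\{\hat\eta(x)>1/2\}$,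 built from the training data $(X_1,Y_1),\dots,(X_n,Y_n)$. Assume that 1. ($h$-hard margin) $|\eta(x)-1/2|\ge h>0$ for all $x\in\operatorname{supp}(\mu)$; 2. $\eta$ is Lipschitz away from the class boundary, i.e. it is Lipschitz on $\{x\in\operatorname{supp}(\mu):\eta(x)<1/2\}$ and on $\{x\in\operatorname{supp}(\mu):\eta(x)>1/2\}$; 3. the class boundary $\partial=\overline{\{x\in\operatorname{supp}(\mu):f^*(x)=0\}}\cap\overline{\{x\in\operatorname{supp}(\mu):f^*(x)=1\}}$ satisfies $\lim_{\epsilon\downarrow 0}\mu\big(\partial+B(0,\epsilon)\big)=0$, where $B(0,\epsilon)$ is the closed Euclidean ball and $+$ is the Minkowski sum. Then there are constants $c_1,c_2>0$, depending only on $h$ (in particular not on $d$, $K$ or the distribution of $(X,Y)$), such that $$\limsup_{n\to\infty}\mathbb E[R(\hat f)]\le R(f^*)\,\bigl(1+c_1e^{-c_2d}\bigr).$$ -/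

import Mathlib

open MeasureTheory ProbabilityTheory Filter Topology Set
open scoped ENNReal NNReal Pointwise

noncomputable section

namespace SimplicialInterpolation

/-- Euclidean space `ℝ^d`. -/
abbrev E (d : ℕ) : Type := EuclideanSpace ℝ (Fin d)

/-! ### Simple polytopes -/

/-- A facet of a convex set `K ⊆ ℝ^d`: a nonempty exposed face of dimension `d - 1`. -/
def IsFacet {d : ℕ} (K F : Set (E d)) : Prop :=
  IsExposed ℝ K F ∧ F.Nonempty ∧ Module.finrank ℝ (vectorSpan ℝ F) + 1 = d

/-- A full-dimensional convex polytope in `ℝ^d` each of whose vertices lies on exactly `d` facets. -/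
structure IsSimplePolytope {d : ℕ} (K : Set (E d)) : Prop where
  polytope : ∃ V : Set (E d), V.Finite ∧ K = convexHull ℝ V
  fullDim : (interior K).Nonempty
  simple : ∀ v ∈ K.extremePoints ℝ, {F : Set (E d) | IsFacet K F ∧ v ∈ F}.ncard = d

/-! ### Delaunay triangulations -/

/-- The Voronoi cell of the `i`-th point of the configuration `x`. -/
def voronoiCell {d n : ℕ} (x : Fin n → E d) (i : Fin n) : Set (E d) :=
  {p | ∀ j, dist p (x i) ≤ dist p (x j)}

/-- `T` is a Delaunay triangulation of the points `x 0, …, x (n - 1)`: a subdivision of their convex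
hull into non-degenerate simplices with vertices among these points (a simplex is given by the
indices of its `d + 1` vertices), any two of which meet in their common face, and such that the
Voronoi cells of the vertices of each simplex have a common point (equivalently, the open ball
bounded by the circumsphere of each simplex contains none of the points). -/
structure IsDelaunayTriangulation {d n : ℕ} (x : Fin n → E d) (T : Set (Finset (Fin n))) :
    Prop where
  card_eq : ∀ s ∈ T, s.card = d + 1
  nondegenerate : ∀ s ∈ T, AffineIndependent ℝ (fun i : s => x i)
  cover : ⋃ s ∈ T, convexHull ℝ (x '' s) = convexHull ℝ (range x)
  inter : ∀ s ∈ T, ∀ t ∈ T,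
    convexHull ℝ (x '' s) ∩ convexHull ℝ (x '' t) = convexHull ℝ (x '' (s ∩ t : Set (Fin n)))
  delaunay : ∀ s ∈ T, ∃ c : E d, ∀ i ∈ s, c ∈ voronoiCell x i

/-- A triangulation scheme: a set of simplices for each configuration of unlabeled examples. -/
abbrev TriangulationScheme (d : ℕ) : Type :=
  ∀ n : ℕ, (Fin n → E d) → Set (Finset (Fin n))

/-- The scheme returns a Delaunay triangulation for each configuration that spans `ℝ^d`. -/
def TriangulationScheme.IsDelaunay {d : ℕ} (T : TriangulationScheme d) : Prop :=
  ∀ (n : ℕ) (x : Fin n → E d), affineSpan ℝ (range x) = ⊤ → IsDelaunayTriangulation x (T n x)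

/-! ### Simplicial interpolation -/

open Classical in
/-- The linear interpolation of the data `(v i, y i)`, `i ∈ s`, at `p`: the value `β₀ + ⟨p, β⟩`, where
`(β₀, β)` solves `β₀ + ⟨v i, β⟩ = y i` for all `i ∈ s`. If `s` indexes the vertices of a
non-degenerate simplex, there is exactly one solution. -/
def linearInterpolation {d n : ℕ} (v : Fin n → E d) (y : Fin n → ℝ) (s : Finset (Fin n)) (p : E d) :
    ℝ :=
  if hb : ∃ b : ℝ × E d, ∀ i ∈ s, b.1 + inner ℝ (v i) b.2 = y i then
    hb.choose.1 + inner ℝ p hb.choose.2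
  else 0

open Classical in
/-- The simplicial interpolant of the data `(x i, y i)` for the set `T` of simplices: at `p` it is
the linear interpolation over a simplex of `T` that contains `p`, and `1 / 2` if there is none. -/
def simplicialInterpolant {d n : ℕ} (T : Set (Finset (Fin n))) (x : Fin n → E d) (y : Fin n → ℝ)
    (p : E d) : ℝ :=
  if hs : ∃ s : Finset (Fin n), s ∈ T ∧ p ∈ convexHull ℝ (x '' s) then
    linearInterpolation x y hs.choose p
  else 1 / 2

/-! ### Classification; labels are elements of `Fin 2`, that is `0` or `1` -/

/-- A label as a real number. -/
def label (y : Fin 2) : ℝ := ((y : ℕ) : ℝ)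

open Classical in
/-- The plug-in classifier `p ↦ 𝟙{g p > 1/2}`. For the conditional mean function `g = η` it is the
Bayes optimal classifier. -/
def plugin {d : ℕ} (g : E d → ℝ) (p : E d) : Fin 2 := if 1 / 2 < g p then 1 else 0

/-- The plug-in classifier based on simplicial interpolation of the labeled examples `z`. -/
def simplicialClassifier {d n : ℕ} (T : TriangulationScheme d) (z : Fin n → E d × Fin 2) :
    E d → Fin 2 :=
  plugin (simplicialInterpolant (T n fun i => (z i).1) (fun i => (z i).1) fun i => label (z i).2)

/-- The zero-one risk `P(f(X) ≠ Y)`, where `(X, Y)` has law `P`. -/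
def risk {d : ℕ} (P : Measure (E d × Fin 2)) (f : E d → Fin 2) : ℝ≥0∞ :=
  P {z | f z.1 ≠ z.2}

/-- The expected risk of the simplicial interpolation classifier trained on `n` independent examples
with law `P`. -/
def expectedRisk {d : ℕ} (P : Measure (E d × Fin 2)) (T : TriangulationScheme d) (n : ℕ) : ℝ≥0∞ :=
  ∫⁻ z, risk P (simplicialClassifier T z) ∂(Measure.pi fun _ : Fin n => P)

/-- `η` is (a version of) the conditional mean `x ↦ E(Y | X = x)`, where `(X, Y)` has law `P`. -/
def IsConditionalMean {d : ℕ} (P : Measure (E d × Fin 2)) (η : E d → ℝ) : Prop :=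
  Measurable η ∧
    P[fun z => label z.2 | MeasurableSpace.comap Prod.fst inferInstance] =ᵐ[P] fun z => η z.1

/-- The `h`-hard margin condition. -/
def HardMargin {d : ℕ} (μ : Measure (E d)) (η : E d → ℝ) (h : ℝ) : Prop :=
  0 < h ∧ ∀ x ∈ μ.support, h ≤ |η x - 1 / 2|

/-- The part of the support of `μ` on which the Bayes classifier predicts `y`. -/
def classRegion {d : ℕ} (μ : Measure (E d)) (η : E d → ℝ) (y : Fin 2) : Set (E d) :=
  {x | x ∈ μ.support ∧ plugin η x = y}

/-- The class boundary: the common boundary of the two class regions. -/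
def classBoundary {d : ℕ} (μ : Measure (E d)) (η : E d → ℝ) : Set (E d) :=
  closure (classRegion μ η 0) ∩ closure (classRegion μ η 1)

/-- `η` is Lipschitz away from the class boundary, that is on each of the two parts `η < 1/2` and
`η > 1/2` of the support of `μ`; it may jump from one part to the other. -/
def LipschitzAwayFromBoundary {d : ℕ} (μ : Measure (E d)) (η : E d → ℝ) : Prop :=
  ∃ L : ℝ≥0, LipschitzOnWith L η {x | x ∈ μ.support ∧ η x < 1 / 2} ∧
    LipschitzOnWith L η {x | x ∈ μ.support ∧ 1 / 2 < η x}

/-- The `ε`-neighbourhoods of the class boundary have vanishing measure as `ε → 0`. -/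
def VanishingBoundary {d : ℕ} (μ : Measure (E d)) (η : E d → ℝ) : Prop :=
  Tendsto (fun ε : ℝ => μ (classBoundary μ η + Metric.closedBall 0 ε)) (𝓝[>] 0) (𝓝 0)

end SimplicialInterpolation

end

noncomputable section

namespace SimplicialInterpolation

/-! ### Integrals of products -/

/-! Fix a small `r` and condition on the unlabeled points. With probability tending to one they are
so dense (`IsNet`) that every Delaunay simplex containing a point outside `nearBoundary` has
diameter at most `4 * r` and lies in a single class region
(`IsDelaunayTriangulation.near_of_notMem_nearBoundary`).

On such a simplex let `e` be the label opposite to the Bayes label. The interpolant can predict `e`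
only where `∑ λ i * a i ≥ 0`, with `λ` the barycentric coordinates and `a i = 1` or `-1` according
to whether vertex `i` carries `e`. Barycentric coordinates of a uniform point are normalised
independent exponentials, so a Chernoff bound limits the volume fraction of this region by `∏ i, (1
- t * a i)⁻¹` (`addHaar_simplex_halfspace_le`). The triangulation does not see the labels, which are
therefore independent given the points; with `t = h` and conditional error probability at most `1 /
2 - h`, each factor has mean at most `chernoffRate h < 1`.

This alone would give an exponentially small excess, not one proportional to the Bayes risk. The
missing factor comes from the fact that `e` is never predicted unless some vertex carries it: a
union over the `d + 1` vertices produces terms that each contain the error probability at a vertex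
(`volume_predicted_le`, `sum_labels_chernoff_le`). The Lipschitz condition moves this probability
from the vertex to any point of the simplex, and summing over simplices, which overlap in null sets,
yields the integral of the error probability, that is, the Bayes risk (`sum_simplex_error_le`).

Letting `n → ∞` and then `r → 0` leaves the relative excess `excessFactor d h`; half of its
exponential rate absorbs the factor `d + 1` (`exists_excessFactor_le`). -/

theorem lintegral_fin_prod_eq_prod {n : ℕ} {α : Fin n → Type*} [∀ i, MeasurableSpace (α i)]
    (μ : ∀ i, Measure (α i)) [∀ i, SigmaFinite (μ i)] (f : ∀ i, α i → ℝ≥0∞)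
    (hf : ∀ i, Measurable (f i)) :
    ∫⁻ x, ∏ i, f i (x i) ∂Measure.pi μ = ∏ i, ∫⁻ x, f i x ∂μ i := by
  induction n with
  | zero => simp
  | succ n ih =>
    have hm : Measurable fun x : ∀ i : Fin n, α i.succ => ∏ i : Fin n, f i.succ (x i) :=
      Finset.measurable_prod _ fun i _ => (hf i.succ).comp (measurable_pi_apply i)
    calc ∫⁻ x, ∏ i, f i (x i) ∂Measure.pi μ
        = ∫⁻ z : α 0 × ((i : Fin n) → α i.succ),
            f 0 z.1 * ∏ i : Fin n, f i.succ (z.2 i)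
              ∂((μ 0).prod (Measure.pi fun i : Fin n => μ i.succ)) := by
          rw [← ((measurePreserving_piFinSuccAbove μ 0).symm).lintegral_comp_emb
            (MeasurableEquiv.measurableEmbedding _)]
          refine lintegral_congr fun z => ?_
          rw [Fin.prod_univ_succ]
          rfl
      _ = ∏ i, ∫⁻ x, f i x ∂μ i := by
          rw [lintegral_prod_mul (f := f 0)
            (g := fun x : ∀ i : Fin n, α i.succ => ∏ i : Fin n, f i.succ (x i))
            (hf 0).aemeasurable hm.aemeasurable,
            ih (fun i => μ i.succ) (fun i => f i.succ) (fun i => hf i.succ), Fin.prod_univ_succ]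

theorem lintegral_fintype_prod_eq_prod {ι : Type*} [Fintype ι] {α : ι → Type*}
    [∀ i, MeasurableSpace (α i)]
    (μ : ∀ i, Measure (α i)) [∀ i, SigmaFinite (μ i)] (f : ∀ i, α i → ℝ≥0∞)
    (hf : ∀ i, Measurable (f i)) :
    ∫⁻ x, ∏ i, f i (x i) ∂Measure.pi μ = ∏ i, ∫⁻ x, f i x ∂μ i := by
  let e := (Fintype.equivFin ι).symm
  rw [← (measurePreserving_piCongrLeft μ e).lintegral_comp_emb
    (MeasurableEquiv.measurableEmbedding _)]
  simp_rw [← e.prod_comp, MeasurableEquiv.coe_piCongrLeft, Equiv.piCongrLeft_apply_apply]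
  exact lintegral_fin_prod_eq_prod (fun i => μ (e i)) (fun i => f (e i)) fun i => hf (e i)

theorem lintegral_Ici_exp_neg_mul {a : ℝ} (ha : 0 < a) :
    ∫⁻ u : ℝ in Ici 0, ENNReal.ofReal (Real.exp (-(a * u))) = ENNReal.ofReal a⁻¹ := by
  rw [← setLIntegral_congr Ioi_ae_eq_Ici, ← ofReal_integral_eq_lintegral_ofReal]
  · congr 1
    have := integral_exp_mul_Ioi (a := -a) (by linarith) 0
    simpa [neg_mul, div_eq_mul_inv] using this
  · have := exp_neg_integrableOn_Ioi 0 ha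
    simpa [neg_mul, IntegrableOn] using this
  · exact Eventually.of_forall fun u => (Real.exp_pos _).le

/-! ### The cone over a simplex -/

section Cone

variable {ι V : Type*} [Fintype ι] [NormedAddCommGroup V] [NormedSpace ℝ V] [FiniteDimensional ℝ V]

/-- The linear bijection `u ↦ (∑ i, u i • b i, ∑ i, u i)` given by an affine basis `b`. -/
def homogenization (b : AffineBasis ι ℝ V) : (ι → ℝ) ≃L[ℝ] V × ℝ :=
  (LinearEquiv.ofBijective
    ((Fintype.linearCombination ℝ (b : ι → V)).prod (Fintype.linearCombination ℝ fun _ => (1 : ℝ)))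
    (by
      have hinj : Function.Injective ((Fintype.linearCombination ℝ (b : ι → V)).prod
          (Fintype.linearCombination ℝ fun _ : ι => (1 : ℝ))) := by
        rw [injective_iff_map_eq_zero]
        intro u hu
        simp only [LinearMap.prod_apply, Function.prod_apply, Fintype.linearCombination_apply,
          Prod.mk_eq_zero, smul_eq_mul, mul_one] at hu
        ext i
        exact affineIndependent_iff.1 b.ind Finset.univ u hu.2 hu.1 i (Finset.mem_univ i)
      refine ⟨hinj, (LinearMap.injective_iff_surjective_of_finrank_eq_finrank ?_).1 hinj⟩
      simp [b.card_eq_finrank_add_one])).toContinuousLinearEquiv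

theorem homogenization_apply (b : AffineBasis ι ℝ V) (u : ι → ℝ) :
    homogenization b u = (∑ i, u i • b i, ∑ i, u i) := by
  have h : homogenization b u = (Fintype.linearCombination ℝ (b : ι → V) u,
    Fintype.linearCombination ℝ (fun _ : ι => (1 : ℝ)) u) := rfl
  simp [h, Fintype.linearCombination_apply]

theorem homogenization_coords (b : AffineBasis ι ℝ V) (p : V) :
    homogenization b (fun i => b.coord i p) = (p, 1) := by
  rw [homogenization_apply]
  simp

variable [MeasurableSpace V] [BorelSpace V]

/-- Homogenization carries Lebesgue measure to a multiple of `μ.prod volume`, and the slice of the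
cone at height `τ` is a `τ`-dilate of the slice at height one. The height integral then separates
from the measure of that slice. The constant `k` is the same for all cones, so it never has to be
computed. -/
theorem exists_lintegral_cone_eq (b : AffineBasis ι ℝ V) (μ : Measure V) [μ.IsAddHaarMeasure] :
    ∃ k : ℝ≥0∞, ∀ D : Set (ι → ℝ), MeasurableSet D → (∀ u ∈ D, ∀ i, 0 ≤ u i) →
      (∀ u ∈ D, ∀ c : ℝ, 0 < c → c • u ∈ D) →
      ∫⁻ u in D, ENNReal.ofReal (Real.exp (-∑ i, u i)) =
        k * μ {p | (fun i => b.coord i p) ∈ D} := by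
  set Ψ := homogenization b
  have hΨm : Measurable Ψ := Ψ.continuous.measurable
  have : ((volume : Measure (ι → ℝ)).map Ψ).IsAddHaarMeasure :=
    Ψ.isAddHaarMeasure_map volume
  set c := ((volume : Measure (ι → ℝ)).map Ψ).addHaarScalarFactor (μ.prod volume)
  have hc : (volume : Measure (ι → ℝ)).map Ψ = c • (μ.prod volume) :=
    Measure.isAddLeftInvariant_eq_smul _ _
  refine ⟨c * ∫⁻ τ : ℝ in Ioi 0,
    ENNReal.ofReal (Real.exp (-τ)) * ENNReal.ofReal (|τ ^ Module.finrank ℝ V|), ?_⟩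
  intro D hD hpos hcone
  set A := {p : V | (fun i => b.coord i p) ∈ D} with hA
  have hsum : ∀ z : V × ℝ, ∑ i, Ψ.symm z i = z.2 := by
    intro z
    have := homogenization_apply b (Ψ.symm z)
    rw [show homogenization b (Ψ.symm z) = z from Ψ.apply_symm_apply z] at this
    exact (congrArg Prod.snd this).symm
  have hone : ∀ p : V, Ψ.symm (p, 1) = fun i => b.coord i p := by
    intro p
    rw [ContinuousLinearEquiv.symm_apply_eq]
    exact (homogenization_coords b p).symm
  have hS : MeasurableSet (Ψ.symm ⁻¹' D) := Ψ.symm.continuous.measurable hD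
  have hslice : ∀ τ : ℝ, 0 < τ → {p : V | Ψ.symm (p, τ) ∈ D} = τ • A := by
    intro τ hτ
    ext p
    have hsc : ∀ q : V, Ψ.symm (τ • q, τ) = τ • fun i => b.coord i q := by
      intro q
      rw [← hone q, ← map_smul]
      simp
    constructor
    · intro hp
      refine ⟨τ⁻¹ • p, ?_, by simp [hτ.ne']⟩
      have h1 := hcone _ hp τ⁻¹ (inv_pos.2 hτ)
      have h2 := hsc (τ⁻¹ • p)
      rw [smul_inv_smul₀ hτ.ne'] at h2
      rw [h2, inv_smul_smul₀ hτ.ne'] at h1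
      exact h1
    · rintro ⟨q, hq, rfl⟩
      change Ψ.symm (τ • q, τ) ∈ D
      rw [hsc q]
      exact hcone _ hq τ hτ
  have hG : Measurable fun z : V × ℝ =>
      (Ψ.symm ⁻¹' D).indicator (fun z => ENNReal.ofReal (Real.exp (-z.2))) z := by
    refine Measurable.indicator ?_ hS
    fun_prop
  calc ∫⁻ u in D, ENNReal.ofReal (Real.exp (-∑ i, u i))
      = ∫⁻ u, (Ψ.symm ⁻¹' D).indicator (fun z => ENNReal.ofReal (Real.exp (-z.2))) (Ψ u) := by
        rw [← lintegral_indicator hD]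
        refine lintegral_congr fun u => ?_
        have hu := hsum (Ψ u)
        rw [Ψ.symm_apply_apply] at hu
        by_cases h : u ∈ D
        · rw [indicator_of_mem h, indicator_of_mem (by simpa using h), hu]
        · rw [indicator_of_notMem h, indicator_of_notMem (by simpa using h)]
    _ = ∫⁻ z, (Ψ.symm ⁻¹' D).indicator (fun z => ENNReal.ofReal (Real.exp (-z.2))) z
          ∂((volume : Measure (ι → ℝ)).map Ψ) := (lintegral_map hG hΨm).symm
    _ = c * ∫⁻ τ : ℝ, ∫⁻ p : V,
          (Ψ.symm ⁻¹' D).indicator (fun z => ENNReal.ofReal (Real.exp (-z.2))) (p, τ) ∂μ := by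
        rw [hc, lintegral_smul_measure, lintegral_prod_symm _ hG.aemeasurable]
        rfl
    _ = c * ∫⁻ τ : ℝ in Ioi 0,
          ENNReal.ofReal (Real.exp (-τ)) * ENNReal.ofReal (|τ ^ Module.finrank ℝ V|) * μ A := by
        congr 1
        rw [← lintegral_indicator measurableSet_Ioi]
        refine lintegral_congr_ae ?_
        have h0 : ∀ᵐ τ : ℝ, τ ≠ 0 := by simp [ae_iff]
        filter_upwards [h0] with τ hτ0
        rcases lt_or_gt_of_ne hτ0 with hτ | hτ
        · rw [indicator_of_notMem (by simpa using hτ.le)]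
          rw [lintegral_eq_zero_of_ae_eq_zero]
          refine Eventually.of_forall fun p => ?_
          refine indicator_of_notMem (fun hp => ?_) _
          have h1 := Finset.sum_nonneg fun i (_ : i ∈ Finset.univ) => hpos _ hp i
          rw [hsum] at h1
          exact absurd h1 (not_le.2 hτ)
        · rw [indicator_of_mem (by simpa using hτ)]
          have : ∀ p : V, (Ψ.symm ⁻¹' D).indicator
              (fun z => ENNReal.ofReal (Real.exp (-z.2))) (p, τ) =
              {p : V | Ψ.symm (p, τ) ∈ D}.indicator
                (fun _ => ENNReal.ofReal (Real.exp (-τ))) p := fun p => rfl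
          simp_rw [this]
          rw [lintegral_indicator_const, hslice τ hτ, Measure.addHaar_smul, mul_assoc]
          exact hS.preimage (by fun_prop : Measurable fun p : V => (p, τ))
    _ = _ := by
        rw [lintegral_mul_const, mul_assoc]
        fun_prop

/-- A Chernoff bound for uniform points of a simplex. Passing to the cone replaces the dependent
barycentric coordinates by independent exponential variables, and the half-space condition, being
homogeneous, survives the passage. -/
theorem addHaar_simplex_halfspace_le (b : AffineBasis ι ℝ V) (μ : Measure V) [μ.IsAddHaarMeasure]
    (a : ι → ℝ) {t : ℝ} (ht : 0 ≤ t) (hta : ∀ i, 0 < 1 - t * a i) :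
    μ {p | (∀ i, 0 ≤ b.coord i p) ∧ 0 ≤ ∑ i, b.coord i p * a i} ≤
      (∏ i, ENNReal.ofReal (1 - t * a i)⁻¹) * μ {p | ∀ i, 0 ≤ b.coord i p} := by
  obtain ⟨k, hk⟩ := exists_lintegral_cone_eq b μ
  have hquad : {u : ι → ℝ | ∀ i, 0 ≤ u i} = univ.pi fun _ => Ici 0 := by
    ext u; simp only [mem_ofPred_eq, Set.mem_pi, mem_univ, true_implies, mem_Ici]
  have hprod : ∀ a : ι → ℝ, (∀ i, 0 < a i) →
      ∫⁻ u in {u : ι → ℝ | ∀ i, 0 ≤ u i}, ENNReal.ofReal (Real.exp (-∑ i, a i * u i)) =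
        ∏ i, ENNReal.ofReal (a i)⁻¹ := by
    intro a ha
    rw [hquad, volume_pi, Measure.restrict_pi_pi]
    simp_rw [← Finset.sum_neg_distrib, Real.exp_sum,
      ENNReal.ofReal_prod_of_nonneg fun i _ => (Real.exp_pos _).le]
    rw [lintegral_fintype_prod_eq_prod (fun _ => (volume : Measure ℝ).restrict (Ici 0))
      (fun i u => ENNReal.ofReal (Real.exp (-(a i * u)))) fun i => by fun_prop]
    exact Finset.prod_congr rfl fun i _ => lintegral_Ici_exp_neg_mul (ha i)
  have hm1 : MeasurableSet {u : ι → ℝ | ∀ i, 0 ≤ u i} := by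
    rw [hquad]; exact MeasurableSet.univ_pi fun _ => measurableSet_Ici
  have hm2 : MeasurableSet {u : ι → ℝ | (∀ i, 0 ≤ u i) ∧ 0 ≤ ∑ i, u i * a i} :=
    hm1.inter (measurableSet_le measurable_const
      (by fun_prop : Measurable fun u : ι → ℝ => ∑ i, u i * a i))
  -- The whole orthant fixes the normalisation: `k` is the reciprocal of the measure of the simplex.
  have h1 : k * μ {p | ∀ i, 0 ≤ b.coord i p} = 1 := by
    refine (hk {u | ∀ i, 0 ≤ u i} hm1 (fun u hu => hu)
      fun u hu c hc i => mul_nonneg hc.le (hu i)).symm.trans ?_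
    simpa using hprod (fun _ => 1) fun _ => one_pos
  have h2 : k * μ {p | (∀ i, 0 ≤ b.coord i p) ∧ 0 ≤ ∑ i, b.coord i p * a i} ≤
      ∏ i, ENNReal.ofReal (1 - t * a i)⁻¹ := by
    refine (hk {u | (∀ i, 0 ≤ u i) ∧ 0 ≤ ∑ i, u i * a i} hm2 (fun u hu => hu.1)
      fun u hu c hc => ⟨fun i => mul_nonneg hc.le (hu.1 i), ?_⟩).symm.le.trans ?_
    rotate_left
    · rw [← hprod _ hta]
      -- On the half-space the exponential tilt `exp (t * ∑ i, u i * a i)` is at least one. After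
      -- inserting it the half-space condition is dropped, and the integral over the orthant
      -- factors.
      refine (setLIntegral_mono (g := fun u : ι → ℝ =>
        ENNReal.ofReal (Real.exp (-∑ i, (1 - t * a i) * u i))) (by fun_prop) ?_).trans
        (lintegral_mono_set (fun u hu => hu.1))
      intro u hu
      refine ENNReal.ofReal_le_ofReal (Real.exp_le_exp.2 (neg_le_neg ?_))
      have : ∑ i, (1 - t * a i) * u i = ∑ i, u i - t * ∑ i, u i * a i := by
        rw [Finset.mul_sum, ← Finset.sum_sub_distrib]
        exact Finset.sum_congr rfl fun i _ => by ring
      rw [this]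
      linarith [mul_nonneg ht hu.2]
    · have := mul_nonneg hc.le hu.2
      rw [Finset.mul_sum] at this
      simpa [mul_assoc] using this
  calc μ {p | (∀ i, 0 ≤ b.coord i p) ∧ 0 ≤ ∑ i, b.coord i p * a i}
      = (k * μ {p | (∀ i, 0 ≤ b.coord i p) ∧ 0 ≤ ∑ i, b.coord i p * a i}) *
          μ {p | ∀ i, 0 ≤ b.coord i p} := by
        rw [mul_right_comm, h1, one_mul]
    _ ≤ _ := by gcongr

end Cone

/-! ### Dense configurations -/

/-- Every ball of radius `r` contained in `K` has a point of the configuration in its interior. -/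
def IsNet {d n : ℕ} (K : Set (E d)) (r : ℝ) (x : Fin n → E d) : Prop :=
  ∀ p, Metric.closedBall p r ⊆ K → ∃ i, dist (x i) p < r

/-- A large empty ball around `c` containing `p` would contain a ball of radius `r` centred within
`r` of `p`. That smaller ball lies in `K`, so its interior contains a point of the configuration. -/
theorem IsNet.radius_lt {d n : ℕ} {K : Set (E d)} {r : ℝ} {x : Fin n → E d} (hx : IsNet K r x)
    (hr : 0 < r) {p c : E d} (hp : Metric.closedBall p (2 * r) ⊆ K) {R : ℝ} (hpc : dist p c ≤ R)
    (hempty : ∀ i, R ≤ dist (x i) c) : R < 2 * r := by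
  by_contra! hR
  -- The centre is `p` itself if it is deep enough in the ball; otherwise `p` is moved by exactly
  -- `r` towards `c`.
  obtain ⟨p', h1, h2⟩ : ∃ p', dist p' p ≤ r ∧ dist p' c ≤ R - r := by
    by_cases hcase : dist p c ≤ R - r
    · exact ⟨p, by simpa using hr.le, hcase⟩
    · have hpos : 0 < dist p c := by linarith
      refine ⟨AffineMap.lineMap p c (r / dist p c), ?_, ?_⟩
      · rw [dist_lineMap_left, Real.norm_of_nonneg (by positivity), div_mul_cancel₀ _ hpos.ne']
      · rw [dist_lineMap_right, Real.norm_of_nonneg, sub_mul, div_mul_cancel₀ _ hpos.ne']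
        · linarith
        · rw [sub_nonneg, div_le_one hpos]
          linarith
  obtain ⟨i, hi⟩ := hx p' ((Metric.closedBall_subset_closedBall' (by linarith)).trans hp)
  have := hempty i
  have := dist_triangle (x i) p' c
  linarith

theorem IsNet.mem_convexHull {d n : ℕ} {K : Set (E d)} {r : ℝ} {x : Fin n → E d}
    (hx : IsNet K r x) (hr : 0 < r) {p : E d} (hp : Metric.closedBall p (2 * r) ⊆ K) :
    p ∈ convexHull ℝ (range x) := by
  by_contra hcon
  obtain ⟨f, u, hfp, hf⟩ := geometric_hahn_banach_point_closed (convex_convexHull ℝ (range x))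
    ((finite_range x).isCompact_convexHull ℝ).isClosed hcon
  set v := (InnerProductSpace.toDual ℝ (E d)).symm f with hv
  have hfv : ∀ z, f z = inner ℝ v z := fun z => by
    rw [hv, InnerProductSpace.toDual_symm_apply]
  have hfx : ∀ i, f p < f (x i) := fun i =>
    hfp.trans (hf _ (subset_convexHull ℝ _ (mem_range_self i)))
  have hball : ∀ q, dist q p ≤ r → Metric.closedBall q r ⊆ K := fun q hq =>
    (Metric.closedBall_subset_closedBall' (by linarith)).trans hp
  have hv0 : v ≠ 0 := by
    intro h0
    obtain ⟨i, -⟩ := hx p (hball p (by simpa using hr.le))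
    have := hfx i
    simp [hfv, h0] at this
  have hvn : 0 < ‖v‖ := norm_pos_iff.2 hv0
  -- A step of length `r` from `p` against the separating normal: the open ball of radius `r` about
  -- the new point lies strictly on the side of `p` that contains no configuration point.
  obtain ⟨i, hi⟩ := hx (p - (r / ‖v‖) • v) (hball _ (by
    rw [dist_eq_norm, sub_sub_cancel_left, norm_neg, norm_smul, Real.norm_of_nonneg (by positivity),
      div_mul_cancel₀ _ hvn.ne']))
  have h1 := hfx i
  have h2 : f (x i) - f p = inner ℝ v (x i - (p - (r / ‖v‖) • v)) - r * ‖v‖ := by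
    rw [hfv, hfv, sub_sub_eq_add_sub, inner_sub_right, inner_add_right, inner_smul_right,
      real_inner_self_eq_norm_sq]
    field_simp
    ring
  have h3 := real_inner_le_norm v (x i - (p - (r / ‖v‖) • v))
  rw [← dist_eq_norm] at h3
  have h4 : ‖v‖ * dist (x i) (p - (r / ‖v‖) • v) < ‖v‖ * r := by gcongr
  linarith

theorem IsNet.affineSpan_eq_top {d n : ℕ} {K : Set (E d)} {r : ℝ} {x : Fin n → E d}
    (hx : IsNet K r x) (hr : 0 < r) {p : E d} (hp : Metric.closedBall p (3 * r) ⊆ K) :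
    affineSpan ℝ (range x) = ⊤ := by
  refine affineSpan_eq_top_of_nonempty_interior ⟨p, ?_⟩
  rw [mem_interior_iff_mem_nhds]
  refine Filter.mem_of_superset (Metric.ball_mem_nhds p hr) fun q hq => ?_
  refine hx.mem_convexHull hr ((Metric.closedBall_subset_closedBall' ?_).trans hp)
  have := Metric.mem_ball.1 hq
  linarith

/-! ### Simplices of a Delaunay triangulation -/

/-- The common point of the Voronoi cells is the centre of an empty ball containing the simplex, and
`IsNet.radius_lt` bounds its radius by `2 * r`. -/
theorem IsDelaunayTriangulation.dist_le {d n : ℕ} {K : Set (E d)} {r : ℝ} {x : Fin n → E d}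
    {T : Set (Finset (Fin n))} (hT : IsDelaunayTriangulation x T) (hx : IsNet K r x) (hr : 0 < r)
    {s : Finset (Fin n)} (hs : s ∈ T) {p : E d} (hp : Metric.closedBall p (2 * r) ⊆ K)
    (hps : p ∈ convexHull ℝ (x '' s)) {q q' : E d} (hq : q ∈ convexHull ℝ (x '' s))
    (hq' : q' ∈ convexHull ℝ (x '' s)) : dist q q' ≤ 4 * r := by
  obtain ⟨c, hc⟩ := hT.delaunay s hs
  obtain ⟨i₀, hi₀⟩ : s.Nonempty := by
    rw [← Finset.card_pos, hT.card_eq s hs]; omega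
  have hsub : convexHull ℝ (x '' s) ⊆ Metric.closedBall c (dist c (x i₀)) := by
    refine convexHull_min ?_ (convex_closedBall _ _)
    rintro _ ⟨i, hi, rfl⟩
    rw [Metric.mem_closedBall, dist_comm]
    exact hc i hi i₀
  have hR := hx.radius_lt hr hp (Metric.mem_closedBall.1 (hsub hps)) fun i => by
    rw [dist_comm (x i)]; exact hc i₀ hi₀ i
  have h1 := Metric.mem_closedBall.1 (hsub hq)
  have h2 := Metric.mem_closedBall.1 (hsub hq')
  have := dist_triangle_right q q' c
  linarith

/-- The affine basis formed by the vertices of a non-degenerate simplex. -/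
def simplexBasis {d n : ℕ} (x : Fin n → E d) (s : Finset (Fin n)) (hcard : s.card = d + 1)
    (hs : AffineIndependent ℝ fun i : s => x i) : AffineBasis s ℝ (E d) :=
  ⟨fun i => x i, hs, by
    rw [hs.affineSpan_eq_top_iff_card_eq_finrank_add_one]
    simp [hcard]⟩

theorem convexHull_simplex_eq {d n : ℕ} (x : Fin n → E d) (s : Finset (Fin n))
    (hcard : s.card = d + 1) (hs : AffineIndependent ℝ fun i : s => x i) :
    convexHull ℝ (x '' s) = {p | ∀ i, 0 ≤ (simplexBasis x s hcard hs).coord i p} := by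
  rw [← AffineBasis.convexHull_eq_nonneg_coord]
  congr 1
  exact image_eq_range x s

theorem linearInterpolation_eq {d n : ℕ} (x : Fin n → E d) (y : Fin n → ℝ) (s : Finset (Fin n))
    (hcard : s.card = d + 1) (hs : AffineIndependent ℝ fun i : s => x i) (p : E d) :
    linearInterpolation x y s p = ∑ i, (simplexBasis x s hcard hs).coord i p * y i := by
  set b := simplexBasis x s hcard hs
  have hbx : ∀ i : s, b i = x i := fun i => rfl
  -- The affine function `∑ i, y i * b.coord i`, split into its value at the origin and its linear
  -- part. Whichever solution is chosen, its value at `p` is forced by the barycentric expansion of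
  -- `p`.
  have hex : ∃ c : ℝ × E d, ∀ i ∈ s, c.1 + inner ℝ (x i) c.2 = y i := by
    let L : E d →ₗ[ℝ] ℝ := ∑ i : s, (y i) • (b.coord i).linear
    refine ⟨(∑ i : s, y i * b.coord i 0,
      (InnerProductSpace.toDual ℝ (E d)).symm L.toContinuousLinearMap), fun i hi => ?_⟩
    rw [real_inner_comm, InnerProductSpace.toDual_symm_apply]
    have hlin : ∀ j : s, (b.coord j).linear (x i) = b.coord j (x i) - b.coord j 0 := fun j => by
      rw [← vsub_eq_sub, ← AffineMap.linearMap_vsub]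
      simp
    simp only [LinearMap.coe_toContinuousLinearMap', L, LinearMap.sum_apply, LinearMap.smul_apply,
      hlin, smul_eq_mul, ← Finset.sum_add_distrib]
    have hcoord : ∀ j : s, b.coord j (x i) = if j = ⟨i, hi⟩ then 1 else 0 := fun j => by
      rw [← hbx ⟨i, hi⟩, AffineBasis.coord_apply]
    simp only [hcoord, mul_sub, add_sub_cancel, mul_ite, mul_one, mul_zero]
    rw [Finset.sum_ite_eq' Finset.univ (⟨i, hi⟩ : s) fun j : s => y j]
    simp
  rw [linearInterpolation, dif_pos hex]
  have hspec := hex.choose_spec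
  set c := hex.choose
  have h1 : ∑ i, b.coord i p = 1 := b.sum_coord_apply_eq_one p
  have h2 : ∑ i, b.coord i p • b i = p := b.linear_combination_coord_eq_self p
  calc c.1 + inner ℝ p c.2
      = (∑ i, b.coord i p) * c.1 + inner ℝ (∑ i, b.coord i p • b i) c.2 := by
        rw [h1, h2, one_mul]
    _ = ∑ i, b.coord i p * (c.1 + inner ℝ (x i) c.2) := by
        rw [Finset.sum_mul, sum_inner, ← Finset.sum_add_distrib]
        refine Finset.sum_congr rfl fun i _ => ?_
        rw [inner_smul_left, hbx]
        simp [mul_add]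
    _ = _ := Finset.sum_congr rfl fun i _ => by rw [hspec i i.2]

/-- The exponential moment factor of a label in the Chernoff bound for the event that the label `e`
is predicted. -/
def labelFactor (t : ℝ) (e y : Fin 2) : ℝ≥0∞ :=
  ENNReal.ofReal (1 - t * if y = e then 1 else -1)⁻¹

/-- The sum over `j` counts the vertices labeled `e`. It is at least one whenever `e` is predicted
anywhere on the simplex, so it costs nothing here; after averaging over labels it supplies the
factor proportional to the Bayes error. -/
theorem volume_predicted_le {d n : ℕ} (x : Fin n → E d) (s : Finset (Fin n))
    (hcard : s.card = d + 1) (hs : AffineIndependent ℝ fun i : s => x i) {t : ℝ} (ht : 0 ≤ t)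
    (ht1 : t < 1) (y : Fin n → Fin 2) (e : Fin 2) :
    volume {p | p ∈ convexHull ℝ (x '' s) ∧
        plugin (linearInterpolation x (fun i => label (y i)) s) p = e} ≤
      (∑ j ∈ s, (if y j = e then 1 else 0) * ∏ i ∈ s, labelFactor t e (y i)) *
        volume (convexHull ℝ (x '' s)) := by
  set b := simplexBasis x s hcard hs
  let a : s → ℝ := fun i => if y i = e then 1 else -1
  have hsub : {p | p ∈ convexHull ℝ (x '' s) ∧
        plugin (linearInterpolation x (fun i => label (y i)) s) p = e} ⊆
      {p | (∀ i, 0 ≤ b.coord i p) ∧ 0 ≤ ∑ i, b.coord i p * a i} := by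
    rintro p ⟨hp, hpe⟩
    rw [convexHull_simplex_eq x s hcard hs] at hp
    refine ⟨hp, ?_⟩
    rw [plugin, linearInterpolation_eq x _ s hcard hs] at hpe
    have h1 : ∑ i, b.coord i p = 1 := b.sum_coord_apply_eq_one p
    have hlab : ∀ z : Fin 2, label z = 0 ∧ z = 0 ∨ label z = 1 ∧ z = 1 := by
      intro z; fin_cases z <;> simp [label]
    -- The signs are an affine recoding of the labels, so comparison with `1 / 2` becomes comparison
    -- with `0`. The closed half-space covers both values of `e`, including the ties, which go to
    -- label `0`.
    have key : ∑ i, b.coord i p * a i =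
        (if e = 1 then 1 else -1) * (2 * ∑ i, b.coord i p * label (y i) - 1) := by
      nth_rw 3 [← h1]
      rw [Finset.mul_sum, ← Finset.sum_sub_distrib, Finset.mul_sum]
      refine Finset.sum_congr rfl fun i _ => ?_
      simp only [a]
      rcases hlab (y i) with ⟨h, h'⟩ | ⟨h, h'⟩ <;> rw [h, h'] <;> fin_cases e <;> simp <;> ring
    rw [key]
    split_ifs at hpe with hgt
    · rw [if_pos hpe.symm]
      linarith
    · rw [if_neg (by omega)]
      linarith
  by_cases hex : ∃ j ∈ s, y j = e
  · obtain ⟨j, hj, hje⟩ := hex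
    have hcher := addHaar_simplex_halfspace_le b volume a ht fun i => by
      simp only [a]; split_ifs <;> linarith
    refine (measure_mono hsub).trans (hcher.trans ?_)
    rw [← convexHull_simplex_eq x s hcard hs]
    gcongr
    have : ∏ i : s, ENNReal.ofReal (1 - t * a i)⁻¹ = ∏ i ∈ s, labelFactor t e (y i) :=
      Finset.prod_coe_sort s fun i => labelFactor t e (y i)
    rw [this]
    refine le_trans ?_ (Finset.single_le_sum (fun _ _ => zero_le) hj)
    simp [hje]
  -- With no vertex labeled `e` the signed combination is `-1` on the whole simplex.
  · push Not at hex
    refine (measure_mono (hsub.trans fun p hp => ?_)).trans (measure_empty.le.trans zero_le)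
    have h1 : ∑ i, b.coord i p = 1 := b.sum_coord_apply_eq_one p
    have h2 : ∑ i, b.coord i p * a i = -1 := by
      rw [← h1, ← Finset.sum_neg_distrib]
      exact Finset.sum_congr rfl fun i _ => by simp [a, hex i i.2]
    have h3 := hp.2
    rw [h2] at h3
    norm_num at h3

/-- Distinct simplices have equally many vertices, so their common face has at most `d` vertices and
spans a proper affine subspace. -/
theorem IsDelaunayTriangulation.volume_inter_eq_zero {d n : ℕ} {x : Fin n → E d}
    {T : Set (Finset (Fin n))} (hT : IsDelaunayTriangulation x T) {s t : Finset (Fin n)}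
    (hs : s ∈ T) (ht : t ∈ T) (hst : s ≠ t) :
    volume (convexHull ℝ (x '' s) ∩ convexHull ℝ (x '' t)) = 0 := by
  classical
  rw [hT.inter s hs t ht]
  refine measure_mono_null (convexHull_subset_affineSpan _) ?_
  refine Measure.addHaar_affineSubspace volume _ fun htop => ?_
  have hlt : (s ∩ t).card < d + 1 := by
    rw [← hT.card_eq s hs]
    refine Finset.card_lt_card (Finset.inter_subset_left.ssubset_of_ne fun heq => hst ?_)
    refine Finset.eq_of_subset_of_card_le (Finset.inter_eq_left.1 heq) ?_
    rw [hT.card_eq s hs, hT.card_eq t ht]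
  have hdir : vectorSpan ℝ (x '' (s ∩ t : Set (Fin n))) = ⊤ := by
    rw [← direction_affineSpan, htop, AffineSubspace.direction_top]
  have hfin : Module.finrank ℝ (vectorSpan ℝ (x '' (s ∩ t : Set (Fin n)))) = d := by
    rw [hdir, finrank_top]; simp
  rcases Nat.eq_zero_or_pos (s ∩ t).card with h0 | hpos
  · rw [Finset.card_eq_zero] at h0
    have : (s ∩ t : Set (Fin n)) = ∅ := by rw [← Finset.coe_inter, h0]; simp
    rw [this, image_empty, AffineSubspace.span_empty] at htop
    exact AffineSubspace.bot_ne_top ℝ (E d) (E d) htop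
  · have := finrank_vectorSpan_image_finset_le ℝ x (s ∩ t) (n := (s ∩ t).card - 1) (by omega)
    rw [Finset.coe_image, Finset.coe_inter, hfin] at this
    omega

/-! ### The class regions -/

/-- A segment inside the support is connected and is covered by the closures of the two class
regions. If its endpoints had different labels, it would meet the class boundary at distance at most
`δ` from `p`. -/
theorem plugin_eq_of_segment_disjoint {d : ℕ} {μ : Measure (E d)} {η : E d → ℝ}
    (hconv : Convex ℝ μ.support) {p q : E d} (hp : p ∈ μ.support) (hq : q ∈ μ.support) {δ : ℝ}
    (hpq : dist p q ≤ δ) (hfar : p ∉ classBoundary μ η + Metric.closedBall 0 δ) :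
    plugin η q = plugin η p := by
  by_contra hne
  have hseg : segment ℝ p q ⊆ μ.support := hconv.segment_subset hp hq
  have hconn : IsPreconnected (segment ℝ p q) := (convex_segment p q).isPreconnected
  rw [isPreconnected_closed_iff] at hconn
  have hcov : ∀ z ∈ μ.support, ∀ e, plugin η z = e → z ∈ closure (classRegion μ η e) :=
    fun z hz e he => subset_closure ⟨hz, he⟩
  have h01 : ∀ e : Fin 2, e = 0 ∨ e = 1 := by decide
  have hpt : ∀ e, (segment ℝ p q ∩ closure (classRegion μ η e)).Nonempty := by
    intro e
    by_cases he : plugin η p = e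
    · exact ⟨p, left_mem_segment ℝ p q, hcov p hp e he⟩
    · exact ⟨q, right_mem_segment ℝ p q, hcov q hq e (by omega)⟩
  obtain ⟨z, hz, hz'⟩ := hconn _ _ isClosed_closure isClosed_closure (fun z hz => by
    rcases h01 (plugin η z) with h | h
    · exact Or.inl (hcov z (hseg hz) 0 h)
    · exact Or.inr (hcov z (hseg hz) 1 h)) (hpt 0) (hpt 1)
  refine hfar ⟨z, hz', p - z, ?_, by simp⟩
  rw [mem_closedBall_zero_iff, ← dist_eq_norm]
  have := (convex_closedBall p δ).segment_subset (Metric.mem_closedBall_self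
    (dist_nonneg.trans hpq)) (Metric.mem_closedBall'.2 hpq) hz
  rw [dist_comm]
  exact this

/-! ### Samples with finitely many labels -/

section Samples

variable {α β : Type*} [MeasurableSpace α] [MeasurableSpace β] [Fintype β]
  {μ : Measure α} {w : α → β → ℝ≥0∞} {P : Measure (α × β)}

theorem lintegral_eq_sum_labels
    (hP : P = ∑ b, (μ.withDensity fun a => w a b).map fun a => (a, b))
    (hw : ∀ b, Measurable fun a => w a b) {f : α × β → ℝ≥0∞} (hf : Measurable f) :
    ∫⁻ z, f z ∂P = ∑ b, ∫⁻ a, f (a, b) * w a b ∂μ := by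
  rw [hP, lintegral_finsetSum_measure]
  refine Finset.sum_congr rfl fun b _ => ?_
  have hm : Measurable fun a => f (a, b) := hf.comp (by fun_prop)
  rw [lintegral_map hf (by fun_prop), lintegral_withDensity_eq_lintegral_mul _ (hw b) hm]
  simp [mul_comm]

theorem measure_eq_sum_labels
    (hP : P = ∑ b, (μ.withDensity fun a => w a b).map fun a => (a, b))
    (hw : ∀ b, Measurable fun a => w a b) {s : Set (α × β)} (hs : MeasurableSet s) :
    P s = ∑ b, ∫⁻ a, s.indicator 1 (a, b) * w a b ∂μ := by
  rw [← lintegral_eq_sum_labels hP hw (measurable_one.indicator hs), lintegral_indicator_one hs]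

theorem pi_eq_sum_labels [SigmaFinite μ] [SigmaFinite P]
    (hP : P = ∑ b, (μ.withDensity fun a => w a b).map fun a => (a, b))
    (hw : ∀ b, Measurable fun a => w a b) (n : ℕ) :
    Measure.pi (fun _ : Fin n => P) = ∑ y : Fin n → β,
      ((Measure.pi fun _ : Fin n => μ).withDensity fun x => ∏ i, w (x i) (y i)).map
        fun x i => (x i, y i) := by
  classical
  refine Measure.pi_eq fun s hs => ?_
  have hm : ∀ y : Fin n → β, Measurable fun (x : Fin n → α) i => (x i, y i) := fun y => by
    fun_prop
  rw [Measure.finsetSum_apply]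
  have hbox : ∀ y : Fin n → β, (((Measure.pi fun _ : Fin n => μ).withDensity
      fun x => ∏ i, w (x i) (y i)).map fun x i => (x i, y i)) (univ.pi s) =
      ∏ i, ∫⁻ a, (s i).indicator 1 (a, y i) * w a (y i) ∂μ := by
    intro y
    have hpre := hm y (MeasurableSet.univ_pi hs)
    rw [Measure.map_apply (hm y) (MeasurableSet.univ_pi hs), withDensity_apply _ hpre,
      ← lintegral_fintype_prod_eq_prod (fun _ : Fin n => μ)
        (fun i a => (s i).indicator 1 (a, y i) * w a (y i)) fun i =>
          (((measurable_one.indicator (hs i)).comp (by fun_prop)).mul (hw (y i))),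
      ← lintegral_indicator hpre]
    refine lintegral_congr fun x => ?_
    rw [Finset.prod_mul_distrib]
    by_cases hx : ∀ i, (x i, y i) ∈ s i
    · rw [indicator_of_mem (by simpa [Set.mem_pi] using hx)]
      simp [hx]
    · rw [indicator_of_notMem (by simpa [Set.mem_pi] using hx)]
      push Not at hx
      obtain ⟨i, hi⟩ := hx
      rw [Finset.prod_eq_zero (Finset.mem_univ i) (by simp [hi]), zero_mul]
  rw [Finset.sum_congr rfl fun y _ => hbox y]
  simp_rw [measure_eq_sum_labels hP hw (hs _)]
  rw [Finset.prod_univ_sum, Fintype.piFinset_univ]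

/-- An upper bound for the lower integral of a function of a labeled sample that is not assumed to be
measurable: the labels may be averaged first. -/
theorem lintegral_pi_le_lintegral_sum [SigmaFinite μ] [SigmaFinite P]
    (hP : P = ∑ b, (μ.withDensity fun a => w a b).map fun a => (a, b))
    (hw : ∀ b, Measurable fun a => w a b) (n : ℕ) (F : (Fin n → α × β) → ℝ≥0∞) :
    ∫⁻ z, F z ∂(Measure.pi fun _ : Fin n => P) ≤
      ∫⁻ x, ∑ y : Fin n → β, F (fun i => (x i, y i)) * ∏ i, w (x i) (y i)
        ∂(Measure.pi fun _ : Fin n => μ) := by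
  classical
  -- A measurable minorant with the same integral stands in for `F`, since the triangulation scheme
  -- need not depend measurably on the points.
  obtain ⟨g, hg, hgF, heq⟩ := exists_measurable_le_lintegral_eq
    (μ := Measure.pi fun _ : Fin n => P) F
  have hm : ∀ y : Fin n → β, Measurable fun (x : Fin n → α) i => (x i, y i) := fun y => by
    fun_prop
  have hwm : ∀ y : Fin n → β, Measurable fun x : Fin n → α => ∏ i, w (x i) (y i) := fun y =>
    Finset.measurable_prod _ fun i _ => (hw (y i)).comp (measurable_pi_apply i)
  rw [heq, pi_eq_sum_labels hP hw, lintegral_finsetSum_measure]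
  calc _ = ∑ y : Fin n → β, ∫⁻ x, g (fun i => (x i, y i)) * ∏ i, w (x i) (y i)
        ∂(Measure.pi fun _ : Fin n => μ) := by
        refine Finset.sum_congr rfl fun y _ => ?_
        have hgm : Measurable fun x : Fin n → α => g fun i => (x i, y i) := hg.comp (hm y)
        rw [lintegral_map hg (hm y), lintegral_withDensity_eq_lintegral_mul _ (hwm y) hgm]
        simp [mul_comm]
    _ = ∫⁻ x, ∑ y : Fin n → β, g (fun i => (x i, y i)) * ∏ i, w (x i) (y i)
        ∂(Measure.pi fun _ : Fin n => μ) :=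
        (lintegral_finsetSum _ fun y _ => (hg.comp (hm y)).mul (hwm y)).symm
    _ ≤ _ := by
        refine lintegral_mono fun x => Finset.sum_le_sum fun y _ => ?_
        gcongr
        exact hgF _

end Samples

/-! ### The conditional distribution of the label -/

/-- The conditional probability of the label `y` at the point `p`. -/
def labelWeight {d : ℕ} (η : E d → ℝ) (p : E d) (y : Fin 2) : ℝ≥0∞ :=
  if y = 1 then ENNReal.ofReal (η p) else ENNReal.ofReal (1 - η p)

theorem measurable_labelWeight {d : ℕ} {η : E d → ℝ} (hη : Measurable η) (y : Fin 2) :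
    Measurable fun p => labelWeight η p y := by
  unfold labelWeight
  split_ifs <;> fun_prop

theorem sum_labelWeight {d : ℕ} {η : E d → ℝ} {p : E d} (hp : η p ∈ Icc (0 : ℝ) 1) :
    ∑ y, labelWeight η p y = 1 := by
  rw [Fin.sum_univ_two]
  simp only [labelWeight, zero_ne_one, if_false, if_true]
  rw [← ENNReal.ofReal_add (by linarith [hp.2]) hp.1]
  simp

theorem label_mem_Icc (y : Fin 2) : label y ∈ Icc (0 : ℝ) 1 := by
  fin_cases y <;> simp [label]

theorem integrable_label {d : ℕ} (P : Measure (E d × Fin 2)) [IsFiniteMeasure P] :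
    Integrable (fun z : E d × Fin 2 => label z.2) P :=
  Integrable.of_bound ((measurable_of_finite label).comp measurable_snd).aestronglyMeasurable 1
    (Eventually.of_forall fun z => by
      rw [Real.norm_of_nonneg (label_mem_Icc z.2).1]; exact (label_mem_Icc z.2).2)

theorem IsConditionalMean.ae_mem_Icc {d : ℕ} {P : Measure (E d × Fin 2)} [IsProbabilityMeasure P]
    {η : E d → ℝ} (hη : IsConditionalMean P η) : ∀ᵐ p ∂P.fst, η p ∈ Icc (0 : ℝ) 1 := by
  have hle : MeasurableSpace.comap Prod.fst inferInstance ≤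
      (inferInstance : MeasurableSpace (E d × Fin 2)) := measurable_fst.comap_le
  have h0 : 0 ≤ᵐ[P] P[fun z => label z.2 | MeasurableSpace.comap Prod.fst inferInstance] :=
    condExp_nonneg (Eventually.of_forall fun z => (label_mem_Icc z.2).1)
  have h1 : P[fun z => label z.2 | MeasurableSpace.comap Prod.fst inferInstance] ≤ᵐ[P]
      P[fun _ => (1 : ℝ) | MeasurableSpace.comap Prod.fst inferInstance] :=
    condExp_mono (integrable_label P) (integrable_const _) (Eventually.of_forall fun z => (label_mem_Icc z.2).2)
  rw [condExp_const hle] at h1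
  rw [Measure.fst, ae_map_iff measurable_fst.aemeasurable (hη.1 measurableSet_Icc)]
  filter_upwards [h0, h1, hη.2] with z hz0 hz1 hz
  rw [hz] at hz0 hz1
  exact ⟨hz0, hz1⟩

/-- Disintegration of `P` over its marginal. The defining property of the conditional expectation
gives the mass of label `1` over each measurable set; label `0` follows by subtracting from the
marginal. -/
theorem IsConditionalMean.measure_eq {d : ℕ} {P : Measure (E d × Fin 2)} [IsProbabilityMeasure P]
    {η : E d → ℝ} (hη : IsConditionalMean P η) :
    P = ∑ y, (P.fst.withDensity fun p => labelWeight η p y).map fun p => (p, y) := by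
  have hle : MeasurableSpace.comap Prod.fst inferInstance ≤
      (inferInstance : MeasurableSpace (E d × Fin 2)) := measurable_fst.comap_le
  have hIcc := hη.ae_mem_Icc
  have hIcc' : ∀ᵐ z ∂P, η z.1 ∈ Icc (0 : ℝ) 1 := by
    rw [Measure.fst, ae_map_iff measurable_fst.aemeasurable (hη.1 measurableSet_Icc)] at hIcc
    exact hIcc
  have hηint : Integrable (fun z : E d × Fin 2 => η z.1) P :=
    Integrable.of_bound (hη.1.comp measurable_fst).aestronglyMeasurable 1
      (hIcc'.mono fun z hz => by rw [Real.norm_of_nonneg hz.1]; exact hz.2)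
  have hone : ∀ B : Set (E d), MeasurableSet B →
      ∫⁻ p in B, labelWeight η p 1 ∂P.fst = P (B ×ˢ {1}) := by
    intro B hB
    have hset := setIntegral_condExp hle (integrable_label P) (s := Prod.fst ⁻¹' B) ⟨B, hB, rfl⟩
    rw [setIntegral_congr_ae (measurable_fst hB) (hη.2.mono fun z hz _ => hz)] at hset
    have hr : ∫ z in Prod.fst ⁻¹' B, label z.2 ∂P = P.real (B ×ˢ {1}) := by
      rw [← integral_indicator (measurable_fst hB), ← integral_indicator_one
        (hB.prod (measurableSet_singleton 1))]
      congr 1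
      ext z
      obtain ⟨p, y⟩ := z
      fin_cases y <;> by_cases hp : p ∈ B <;> simp [indicator, label, hp]
    simp only [labelWeight, if_true]
    rw [Measure.fst, setLIntegral_map hB (hη.1.ennreal_ofReal) measurable_fst,
      ← ofReal_integral_eq_lintegral_ofReal hηint.integrableOn
        (ae_restrict_of_ae (hIcc'.mono fun z hz => hz.1)), hset, hr, ofReal_measureReal]
  have htwo : ∀ B : Set (E d), MeasurableSet B →
      P (B ×ˢ {0}) + P (B ×ˢ {1}) = P.fst B := by
    intro B hB
    rw [← measure_union (by
      rw [Set.disjoint_left]; rintro ⟨p, y⟩ ⟨-, h0⟩ ⟨-, h1⟩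
      simp only [mem_singleton_iff] at h0 h1
      omega) (hB.prod (measurableSet_singleton 1)), Measure.fst_apply hB]
    congr 1
    ext ⟨p, y⟩
    fin_cases y <;> simp
  have hzero : ∀ B : Set (E d), MeasurableSet B →
      ∫⁻ p in B, labelWeight η p 0 ∂P.fst = P (B ×ˢ {0}) := by
    intro B hB
    have hsum : ∫⁻ p in B, labelWeight η p 0 ∂P.fst + ∫⁻ p in B, labelWeight η p 1 ∂P.fst =
        P.fst B := by
      rw [← lintegral_add_left (measurable_labelWeight hη.1 0)]
      rw [lintegral_congr_ae (g := fun _ => 1)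
        (ae_restrict_of_ae (hIcc.mono fun p hp => ?_))]
      · simp
      · have := sum_labelWeight hp
        rwa [Fin.sum_univ_two] at this
    rw [hone B hB, ← htwo B hB] at hsum
    exact (ENNReal.add_left_inj (measure_ne_top _ _)).1 hsum
  ext A hA
  have hsec : ∀ y : Fin 2, MeasurableSet ((fun p : E d => (p, y)) ⁻¹' A) := fun y =>
    (by fun_prop : Measurable fun p : E d => (p, y)) hA
  rw [Measure.finsetSum_apply, Fin.sum_univ_two, Measure.map_apply (by fun_prop) hA,
    Measure.map_apply (by fun_prop) hA, withDensity_apply _ (hsec 0), withDensity_apply _ (hsec 1),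
    hzero _ (hsec 0), hone _ (hsec 1), ← measure_union _ ((hsec 1).prod (measurableSet_singleton 1))]
  · congr 1
    ext ⟨p, y⟩
    fin_cases y <;> simp
  · rw [Set.disjoint_left]; rintro ⟨p, y⟩ ⟨-, h0⟩ ⟨-, h1⟩
    simp only [mem_singleton_iff] at h0 h1
    omega

/-- The label that differs from `e`. -/
def otherLabel (e : Fin 2) : Fin 2 := 1 - e

theorem otherLabel_ne (e : Fin 2) : otherLabel e ≠ e := by revert e; decide

theorem eq_otherLabel_of_ne {e y : Fin 2} (h : y ≠ e) : y = otherLabel e := by revert e y; decide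

theorem measurable_plugin {d : ℕ} {η : E d → ℝ} (hη : Measurable η) : Measurable (plugin η) := by
  unfold plugin
  exact Measurable.ite (measurableSet_lt measurable_const hη) measurable_const measurable_const

theorem IsConditionalMean.lintegral_le_risk {d : ℕ} {P : Measure (E d × Fin 2)}
    [IsProbabilityMeasure P] {η : E d → ℝ} (hη : IsConditionalMean P η) :
    ∫⁻ p, labelWeight η p (otherLabel (plugin η p)) ∂P.fst ≤ risk P (plugin η) := by
  have hpl := measurable_plugin hη.1
  have hm : MeasurableSet {z : E d × Fin 2 | plugin η z.1 ≠ z.2} :=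
    (measurableSet_eq_fun (hpl.comp measurable_fst) measurable_snd).compl
  have hind : ∀ y : Fin 2, Measurable fun p : E d =>
      {z : E d × Fin 2 | plugin η z.1 ≠ z.2}.indicator (1 : E d × Fin 2 → ℝ≥0∞) (p, y) *
        labelWeight η p y := fun y =>
    ((measurable_one.indicator hm).comp (by fun_prop)).mul (measurable_labelWeight hη.1 y)
  rw [risk, measure_eq_sum_labels hη.measure_eq (measurable_labelWeight hη.1) hm,
    ← lintegral_finsetSum _ fun y _ => hind y]
  refine lintegral_mono fun p => ?_
  refine le_trans ?_ (Finset.single_le_sum (fun _ _ => zero_le)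
    (Finset.mem_univ (otherLabel (plugin η p))))
  rw [indicator_of_mem (by simpa using (otherLabel_ne (plugin η p)).symm)]
  simp

/-! ### Averaging over the labels -/

/-- For fixed `j` the sum over label vectors factors over the indices: index `j` contributes `w j e
* g e`, each other index of `s` at most `ρ`, and each index outside `s` exactly one. -/
theorem sum_labels_chernoff_le {n : ℕ} (w : Fin n → Fin 2 → ℝ≥0∞) (hw : ∀ i, ∑ y, w i y = 1)
    (s : Finset (Fin n)) (g : Fin 2 → ℝ≥0∞) (e : Fin 2) {ρ : ℝ≥0∞}
    (hρ : ∀ i ∈ s, ∑ y, w i y * g y ≤ ρ) :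
    ∑ y : Fin n → Fin 2, (∑ j ∈ s, (if y j = e then 1 else 0) * ∏ i ∈ s, g (y i)) *
        ∏ i, w i (y i) ≤ ∑ j ∈ s, w j e * g e * ρ ^ (s.card - 1) := by
  classical
  simp_rw [Finset.sum_mul]
  rw [Finset.sum_comm]
  refine Finset.sum_le_sum fun j hj => ?_
  let G : Fin n → Fin 2 → ℝ≥0∞ := fun i b =>
    (if i = j then (if b = e then 1 else 0) else 1) * (if i ∈ s then g b else 1) * w i b
  have hG : ∀ y : Fin n → Fin 2,
      (if y j = e then 1 else 0) * (∏ i ∈ s, g (y i)) * ∏ i, w i (y i) = ∏ i, G i (y i) := by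
    intro y
    simp only [G, Finset.prod_mul_distrib]
    congr 2
    · rw [Finset.prod_ite_eq' Finset.univ j fun i => if y i = e then (1 : ℝ≥0∞) else 0]
      simp
    · simp [Finset.prod_ite_mem]
  rw [Finset.sum_congr rfl fun y _ => hG y]
  have hswap : ∑ y : Fin n → Fin 2, ∏ i, G i (y i) = ∏ i, ∑ b, G i b := by
    rw [Finset.prod_univ_sum, Fintype.piFinset_univ]
  rw [hswap, ← Finset.prod_subset (Finset.subset_univ s) fun i _ hi => ?_,
    ← Finset.mul_prod_erase s _ hj, ← Finset.card_erase_of_mem hj]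
  · refine mul_le_mul' (le_of_eq ?_) (Finset.prod_le_pow_card _ _ _ fun i hi => ?_)
    · rw [Finset.sum_eq_single e (fun b _ hb => by simp [G, hb]) (by simp)]
      simp [G, hj, mul_comm]
    · obtain ⟨h1, h2⟩ := Finset.mem_erase.1 hi
      simpa [G, h1, h2, mul_comm] using hρ i h2
  · have hij : i ≠ j := fun h => hi (h ▸ hj)
    simpa [G, hij, hi] using hw i

/-! ### The uniform distribution on a convex body -/

section Uniform

variable {d : ℕ} {K : Set (E d)}

theorem isProbabilityMeasure_cond_of_isCompact (hK : IsCompact K) (hint : (interior K).Nonempty) :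
    IsProbabilityMeasure (volume[|K]) :=
  cond_isProbabilityMeasure_of_finite
    (Measure.measure_pos_of_nonempty_interior _ hint).ne' hK.measure_lt_top.ne

theorem cond_pos_of_isOpen (hK : IsCompact K) {U : Set (E d)} (hU : IsOpen U)
    (hUK : (U ∩ interior K).Nonempty) : 0 < (volume[|K]) U := by
  rw [cond_apply hK.measurableSet]
  refine ENNReal.mul_pos (ENNReal.inv_ne_zero.2 hK.measure_lt_top.ne) ?_
  refine (((hU.inter isOpen_interior).measure_pos volume hUK).trans_le (measure_mono ?_)).ne'
  exact fun p hp => ⟨interior_subset hp.2, hp.1⟩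

theorem support_cond_eq (hK : IsCompact K) (hconv : Convex ℝ K) (hint : (interior K).Nonempty) :
    (volume[|K]).support = K := by
  refine subset_antisymm ?_ fun p hp => ?_
  · refine Measure.support_subset_of_isClosed hK.isClosed ?_
    exact ae_cond_mem hK.measurableSet
  · rw [Measure.mem_support_iff_forall]
    intro U hU
    obtain ⟨W, hWU, hW, hpW⟩ := mem_nhds_iff.1 hU
    refine (cond_pos_of_isOpen hK hW ?_).trans_le (measure_mono hWU)
    -- A convex set with interior points lies in the closure of its interior, so each neighbourhood
    -- of `p` has positive mass.
    have hcl : p ∈ closure (interior K) := by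
      rw [hconv.closure_interior_eq_closure_of_nonempty_interior hint]
      exact subset_closure hp
    exact mem_closure_iff.1 hcl W hW hpW

theorem tendsto_measure_not_isNet (hK : IsCompact K) (hint : (interior K).Nonempty) {r : ℝ}
    (hr : 0 < r) :
    Tendsto (fun n => (Measure.pi fun _ : Fin n => volume[|K]) {x | ¬ IsNet K r x}) atTop
      (𝓝 0) := by
  have := isProbabilityMeasure_cond_of_isCompact hK hint
  have hsub : {p | Metric.closedBall p r ⊆ K} ⊆ K := fun p hp =>
    hp (Metric.mem_closedBall_self hr.le)
  -- Finitely many admissible centres approximate all others within `r / 2`. A configuration that is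
  -- not a net misses one of the balls of radius `r / 2` about them, each of which has positive
  -- mass.
  obtain ⟨Q, hQK, hQ, hcov⟩ := Metric.finite_approx_of_totallyBounded
    (hK.totallyBounded.subset hsub) (r / 2) (by linarith)
  lift Q to Finset (E d) using hQ
  have hbound : ∀ n, (Measure.pi fun _ : Fin n => volume[|K]) {x | ¬ IsNet K r x} ≤
      ∑ q ∈ Q, ((volume[|K]) (Metric.ball q (r / 2))ᶜ) ^ n := by
    intro n
    have hincl : {x : Fin n → E d | ¬ IsNet K r x} ⊆
        ⋃ q ∈ Q, univ.pi fun _ => (Metric.ball q (r / 2))ᶜ := by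
      intro x hx
      simp only [IsNet, mem_ofPred_eq, not_forall, not_exists, not_lt] at hx
      obtain ⟨p, hp, hfar⟩ := hx
      obtain ⟨q, hq, hpq⟩ := mem_iUnion₂.1 (hcov hp)
      refine mem_iUnion₂.2 ⟨q, hq, fun i _ hi => ?_⟩
      have h1 := hfar i
      have h2 := Metric.mem_ball.1 hi
      have h3 := Metric.mem_ball.1 hpq
      have := dist_triangle_right (x i) p q
      linarith
    refine (measure_mono hincl).trans ((measure_biUnion_finset_le _ _).trans ?_)
    refine Finset.sum_le_sum fun q _ => ?_
    rw [Measure.pi_pi]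
    simp
  have hlim : Tendsto (fun n => ∑ q ∈ Q, ((volume[|K]) (Metric.ball q (r / 2))ᶜ) ^ n) atTop
      (𝓝 (∑ q ∈ Q, 0)) := by
    refine tendsto_finsetSum _ fun q hq => ENNReal.tendsto_pow_atTop_nhds_zero_of_lt_one ?_
    rw [prob_compl_eq_one_sub Metric.isOpen_ball.measurableSet]
    refine ENNReal.sub_lt_self ENNReal.one_ne_top one_ne_zero
      (cond_pos_of_isOpen hK Metric.isOpen_ball ?_).ne'
    refine ⟨q, Metric.mem_ball_self (by linarith), ?_⟩
    exact interior_mono (hQK hq) (Metric.ball_subset_interior_closedBall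
      (Metric.mem_ball_self hr))
  rw [Finset.sum_const_zero] at hlim
  exact tendsto_of_tendsto_of_tendsto_of_le_of_le tendsto_const_nhds hlim (fun _ => zero_le) hbound

/-- These points lie in shrinking thickenings of the complement of `K`, whose intersection meets `K`
only in its frontier, a null set by convexity. -/
theorem tendsto_measure_near_frontier (hK : IsCompact K) (hconv : Convex ℝ K)
    (hint : (interior K).Nonempty) :
    Tendsto (fun r : ℝ => (volume[|K]) {p | ¬ Metric.closedBall p r ⊆ K}) (𝓝 0) (𝓝 0) := by
  have := isProbabilityMeasure_cond_of_isCompact hK hint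
  have h := tendsto_measure_cthickening (μ := volume[|K]) (s := Kᶜ)
    ⟨1, one_pos, measure_ne_top _ _⟩
  have h0 : (volume[|K]) (closure Kᶜ) = 0 := by
    rw [cond_apply hK.measurableSet]
    refine mul_eq_zero_of_right _ (measure_mono_null ?_ (hconv.addHaar_frontier volume))
    intro p hp
    rw [frontier_eq_closure_inter_closure]
    exact ⟨subset_closure hp.1, hp.2⟩
  rw [h0] at h
  refine tendsto_of_tendsto_of_tendsto_of_le_of_le tendsto_const_nhds h (fun _ => zero_le)
    fun r => measure_mono fun p hp => ?_
  obtain ⟨q, hq, hqK⟩ := not_subset.1 hp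
  exact Metric.mem_cthickening_of_dist_le p q r _ hqK (Metric.mem_closedBall'.1 hq)

end Uniform

/-! ### The error label at a point of a class region -/

section ErrorLabel

variable {d : ℕ} {η : E d → ℝ} {p : E d}

/-- The conditional probability of error of the plug-in classifier at a point, as a real number. -/
def bayesError (η : E d → ℝ) (p : E d) : ℝ := if plugin η p = 1 then 1 - η p else η p

theorem labelWeight_otherLabel_plugin : labelWeight η p (otherLabel (plugin η p)) =
    ENNReal.ofReal (bayesError η p) := by
  unfold labelWeight bayesError
  have h01 : ∀ e : Fin 2, e = 0 ∨ e = 1 := by decide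
  rcases h01 (plugin η p) with h | h <;> simp [h, otherLabel]

theorem labelWeight_plugin : labelWeight η p (plugin η p) =
    ENNReal.ofReal (1 - bayesError η p) := by
  unfold labelWeight bayesError
  have h01 : ∀ e : Fin 2, e = 0 ∨ e = 1 := by decide
  rcases h01 (plugin η p) with h | h <;> simp [h]

theorem plugin_eq_one_iff : plugin η p = 1 ↔ 1 / 2 < η p := by
  unfold plugin
  split_ifs with h
  · exact iff_of_true rfl h
  · exact iff_of_false (by decide) h

theorem HardMargin.bayesError_le {μ : Measure (E d)} {h : ℝ} (hm : HardMargin μ η h)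
    (hp : p ∈ μ.support) : bayesError η p ≤ 1 / 2 - h := by
  have h1 := hm.2 p hp
  unfold bayesError
  split_ifs with hpl
  · rw [plugin_eq_one_iff] at hpl
    rw [abs_of_pos (by linarith)] at h1
    linarith
  · rw [plugin_eq_one_iff, not_lt] at hpl
    rw [abs_of_nonpos (by linarith)] at h1
    linarith

theorem bayesError_nonneg (hp : η p ∈ Icc (0 : ℝ) 1) : 0 ≤ bayesError η p := by
  unfold bayesError
  split_ifs
  · linarith [hp.2]
  · exact hp.1

/-- Points with equal Bayes labels lie in the same Lipschitz piece; for label `0` this needs the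
margin, which excludes the value `1 / 2`. -/
theorem bayesError_le_add {μ : Measure (E d)} {h : ℝ} (hm : HardMargin μ η h) {L : ℝ≥0}
    (h0 : LipschitzOnWith L η {x | x ∈ μ.support ∧ η x < 1 / 2})
    (h1 : LipschitzOnWith L η {x | x ∈ μ.support ∧ 1 / 2 < η x}) {q : E d}
    (hp : p ∈ μ.support) (hq : q ∈ μ.support) (hpq : plugin η q = plugin η p) {δ : ℝ}
    (hδ : dist q p ≤ δ) : bayesError η q ≤ bayesError η p + L * δ := by
  have hLδ : L * dist q p ≤ L * δ := by gcongr
  unfold bayesError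
  rw [hpq]
  split_ifs with hpl
  · have := h1.dist_le_mul q ⟨hq, plugin_eq_one_iff.1 (hpq.trans hpl)⟩ p
      ⟨hp, plugin_eq_one_iff.1 hpl⟩
    rw [Real.dist_eq] at this
    linarith [neg_abs_le (η q - η p)]
  · have hlt : ∀ z ∈ μ.support, plugin η z ≠ 1 → η z < 1 / 2 := by
      intro z hz hz1
      rw [Ne, plugin_eq_one_iff, not_lt] at hz1
      have := hm.2 z hz
      rw [abs_of_nonpos (by linarith)] at this
      linarith [hm.1]
    have := h0.dist_le_mul q ⟨hq, hlt q hq (hpq ▸ hpl)⟩ p ⟨hp, hlt p hp hpl⟩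
    rw [Real.dist_eq] at this
    linarith [le_abs_self (η q - η p)]

/-- The base of the exponential rate. -/
def chernoffRate (h : ℝ) : ℝ := (1 - 2 * h ^ 2) / (1 - h ^ 2)

/-- With error probability `q` and tilt `h` the mean is `(1 - h * (1 - 2 * q)) / (1 - h ^ 2)`. It
increases with `q`, so the extreme case is `q = 1 / 2 - h`. -/
theorem HardMargin.sum_labelWeight_mul_labelFactor_le {μ : Measure (E d)} {h : ℝ}
    (hm : HardMargin μ η h) (hh : h ≤ 1 / 2) (hp : p ∈ μ.support) (hp1 : η p ∈ Icc (0 : ℝ) 1) :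
    ∑ y, labelWeight η p y * labelFactor h (otherLabel (plugin η p)) y ≤
      ENNReal.ofReal (chernoffRate h) := by
  have hsum : ∀ (f : Fin 2 → ℝ≥0∞) (e : Fin 2), ∑ y, f y = f e + f (otherLabel e) := by
    intro f e
    have h01 : ∀ e : Fin 2, e = 0 ∨ e = 1 := by decide
    rcases h01 e with h | h <;> simp [h, otherLabel, Fin.sum_univ_two, add_comm]
  rw [hsum _ (plugin η p), labelWeight_plugin, labelWeight_otherLabel_plugin, labelFactor, labelFactor,
    if_neg (otherLabel_ne _).symm, if_pos rfl]
  have hq0 := bayesError_nonneg hp1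
  have hq1 := hm.bayesError_le hp
  have hh0 := hm.1
  set q := bayesError η p
  have hpos : 0 < 1 - h := by linarith
  have hpos' : 0 < 1 - h ^ 2 := by nlinarith
  rw [← ENNReal.ofReal_mul (by linarith), ← ENNReal.ofReal_mul hq0,
    ← ENNReal.ofReal_add (mul_nonneg (by linarith) (inv_nonneg.2 (by linarith)))
      (mul_nonneg hq0 (inv_nonneg.2 (by linarith)))]
  refine ENNReal.ofReal_le_ofReal ?_
  have heq : (1 - q) * (1 - h * -1)⁻¹ + q * (1 - h * 1)⁻¹ = (1 - h * (1 - 2 * q)) / (1 - h ^ 2) := by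
    have h2 : 1 + h ≠ 0 := by linarith
    have h3 : 1 - h ≠ 0 := hpos.ne'
    have h4 : 1 - h ^ 2 = (1 - h) * (1 + h) := by ring
    rw [h4, show 1 - h * -1 = 1 + h by ring, show 1 - h * 1 = 1 - h by ring]
    field_simp
    ring
  rw [heq, chernoffRate]
  exact div_le_div_of_nonneg_right (by nlinarith) hpos'.le

end ErrorLabel

/-! ### The risk for a fixed dense configuration -/

/-- The points close to the boundary of `K` or to the class boundary. -/
def nearBoundary {d : ℕ} (K : Set (E d)) (μ : Measure (E d)) (η : E d → ℝ) (r : ℝ) : Set (E d) :=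
  {p | ¬ Metric.closedBall p (2 * r) ⊆ K} ∪ (classBoundary μ η + Metric.closedBall 0 (4 * r))

/-- The bound for the relative excess risk, before simplification. -/
def excessFactor (d : ℕ) (h : ℝ) : ℝ≥0∞ :=
  (d + 1) * (ENNReal.ofReal (1 - h)⁻¹ * ENNReal.ofReal (chernoffRate h) ^ d)

theorem risk_le_risk_add {d : ℕ} (P : Measure (E d × Fin 2)) (f g : E d → Fin 2) :
    risk P f ≤ risk P g + P.fst {p | f p ≠ g p} := by
  have hsub : {z : E d × Fin 2 | f z.1 ≠ z.2} ⊆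
      {z | g z.1 ≠ z.2} ∪ Prod.fst ⁻¹' {p | f p ≠ g p} := by
    intro z hz
    by_cases h : g z.1 = z.2
    · exact Or.inr fun hfg => hz (hfg.trans h)
    · exact Or.inl h
  refine (measure_mono hsub).trans ((measure_union_le _ _).trans ?_)
  exact add_le_add_right (Measure.le_map_apply measurable_fst.aemeasurable _) _

section FixedSample

variable {d n : ℕ} {K : Set (E d)} {η : E d → ℝ} {r : ℝ} {x : Fin n → E d}
  {T : Set (Finset (Fin n))}

theorem convexHull_simplex_subset (hconv : Convex ℝ K) (hxK : ∀ i, x i ∈ K) (s : Finset (Fin n)) :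
    convexHull ℝ (x '' s) ⊆ K := by
  refine convexHull_min ?_ hconv
  rintro _ ⟨i, -, rfl⟩
  exact hxK i

/-- The two radii in `nearBoundary` are made for this: `2 * r` makes the diameter bound applicable,
and `4 * r` is that bound, so the simplex cannot reach another class. -/
theorem IsDelaunayTriangulation.near_of_notMem_nearBoundary (hT : IsDelaunayTriangulation x T)
    (hK : IsCompact K) (hconv : Convex ℝ K) (hint : (interior K).Nonempty) (hxK : ∀ i, x i ∈ K)
    (hx : IsNet K r x) (hr : 0 < r) {s : Finset (Fin n)} (hs : s ∈ T) {p q : E d}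
    (hp : p ∈ convexHull ℝ (x '' s)) (hpb : p ∉ nearBoundary K (volume[|K]) η r)
    (hq : q ∈ convexHull ℝ (x '' s)) : plugin η q = plugin η p ∧ dist q p ≤ 4 * r := by
  rw [nearBoundary, mem_union, not_or] at hpb
  obtain ⟨h1, h2⟩ := hpb
  have hball : Metric.closedBall p (2 * r) ⊆ K := not_not.1 h1
  have hsupp := support_cond_eq hK hconv hint
  have hsK := convexHull_simplex_subset hconv hxK s
  have hdist := hT.dist_le hx hr hs hball hp hq hp
  refine ⟨plugin_eq_of_segment_disjoint (μ := volume[|K]) ?_ ?_ ?_ ((dist_comm p q).trans_le hdist)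
    h2, hdist⟩
  · rwa [hsupp]
  · rw [hsupp]; exact hsK hp
  · rw [hsupp]; exact hsK hq

theorem IsDelaunayTriangulation.sum_lintegral_le (hT : IsDelaunayTriangulation x T)
    (S : Finset (Finset (Fin n))) (hS : ∀ s ∈ S, s ∈ T) (f : E d → ℝ≥0∞) :
    ∑ s ∈ S, ∫⁻ p in convexHull ℝ (x '' s), f p ∂volume[|K] ≤ ∫⁻ p, f p ∂volume[|K] := by
  rw [← lintegral_biUnion_finset₀]
  · exact setLIntegral_le_lintegral _ _
  · intro s hs t ht hst
    exact cond_absolutelyContinuous (hT.volume_inter_eq_zero (hS s hs) (hS t ht) hst)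
  · intro s _
    exact ((s.finite_toSet.image x).isCompact_convexHull ℝ).isClosed.measurableSet.nullMeasurableSet

theorem cond_predicted_le (hT : IsDelaunayTriangulation x T) (hK : IsCompact K)
    (hconv : Convex ℝ K) (hxK : ∀ i, x i ∈ K) {s : Finset (Fin n)} (hs : s ∈ T) {t : ℝ}
    (ht : 0 ≤ t) (ht1 : t < 1) (y : Fin n → Fin 2) (e : Fin 2) :
    (volume[|K]) {p | p ∈ convexHull ℝ (x '' s) ∧
        plugin (linearInterpolation x (fun i => label (y i)) s) p = e} ≤
      (∑ j ∈ s, (if y j = e then 1 else 0) * ∏ i ∈ s, labelFactor t e (y i)) *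
        (volume[|K]) (convexHull ℝ (x '' s)) := by
  have hsK := convexHull_simplex_subset hconv hxK s
  rw [cond_apply hK.measurableSet, cond_apply hK.measurableSet, inter_eq_right.2 hsK,
    inter_eq_right.2 fun p hp => hsK hp.1, mul_left_comm]
  gcongr
  exact volume_predicted_le x s (hT.card_eq s hs) (hT.nondegenerate s hs) ht ht1 y e

theorem cond_disagreement_le (hT : IsDelaunayTriangulation x T) (hK : IsCompact K)
    (hconv : Convex ℝ K) (hxK : ∀ i, x i ∈ K) (hx : IsNet K r x) (hr : 0 < r)
    {t : ℝ} (ht : 0 ≤ t) (ht1 : t < 1) (S : Finset (Finset (Fin n)))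
    (hS : ∀ s, s ∈ S ↔ s ∈ T ∧ ∃ p ∈ convexHull ℝ (x '' s), p ∉ nearBoundary K (volume[|K]) η r)
    (e : Finset (Fin n) → Fin 2)
    (he : ∀ s ∈ S, ∀ q ∈ convexHull ℝ (x '' s), plugin η q = e s) (y : Fin n → Fin 2) :
    (volume[|K]) {p | plugin (simplicialInterpolant T x fun i => label (y i)) p ≠ plugin η p} ≤
      (volume[|K]) (nearBoundary K (volume[|K]) η r) +
        ∑ s ∈ S, (∑ j ∈ s, (if y j = otherLabel (e s) then 1 else 0) *
          ∏ i ∈ s, labelFactor t (otherLabel (e s)) (y i)) * (volume[|K]) (convexHull ℝ (x '' s)) := by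
  have hsub : {p | plugin (simplicialInterpolant T x fun i => label (y i)) p ≠ plugin η p} ⊆
      nearBoundary K (volume[|K]) η r ∪ ⋃ s ∈ S, {p | p ∈ convexHull ℝ (x '' s) ∧
        plugin (linearInterpolation x (fun i => label (y i)) s) p = otherLabel (e s)} := by
    intro p hp
    by_cases hpb : p ∈ nearBoundary K (volume[|K]) η r
    · exact Or.inl hpb
    have hball : Metric.closedBall p (2 * r) ⊆ K := by
      by_contra hcon
      exact hpb (Or.inl hcon)
    have hhull := hx.mem_convexHull hr hball
    rw [← hT.cover] at hhull
    have hex : ∃ s : Finset (Fin n), s ∈ T ∧ p ∈ convexHull ℝ (x '' s) := by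
      obtain ⟨s, hs, hps⟩ := mem_iUnion₂.1 hhull
      exact ⟨s, hs, hps⟩
    obtain ⟨hsT, hps⟩ := hex.choose_spec
    have hsS : hex.choose ∈ S := (hS _).2 ⟨hsT, p, hps, hpb⟩
    refine Or.inr (mem_iUnion₂.2 ⟨hex.choose, hsS, hps, eq_otherLabel_of_ne ?_⟩)
    rw [← he _ hsS p hps]
    have hval : plugin (simplicialInterpolant T x fun i => label (y i)) p =
        plugin (linearInterpolation x (fun i => label (y i)) hex.choose) p := by
      simp only [plugin, simplicialInterpolant, dif_pos hex]
    rw [← hval]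
    exact hp
  refine (measure_mono hsub).trans ((measure_union_le _ _).trans ?_)
  gcongr
  refine (measure_biUnion_finset_le _ _).trans (Finset.sum_le_sum fun s hs => ?_)
  exact cond_predicted_le hT hK hconv hxK ((hS s).1 hs).1 ht ht1 y _

/-- The error probability at a vertex is compared with that at each point of the simplex and the
comparison is integrated; the `d + 1` vertices give the prefactor. -/
theorem sum_simplex_error_le (hT : IsDelaunayTriangulation x T) (hK : IsCompact K)
    (hconv : Convex ℝ K) (hint : (interior K).Nonempty) (hxK : ∀ i, x i ∈ K)
    (hη : Measurable η)
    (hx : IsNet K r x) (hr : 0 < r) {h : ℝ} (hm : HardMargin (volume[|K]) η h) {L : ℝ≥0}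
    (hL0 : LipschitzOnWith L η {x | x ∈ (volume[|K]).support ∧ η x < 1 / 2})
    (hL1 : LipschitzOnWith L η {x | x ∈ (volume[|K]).support ∧ 1 / 2 < η x})
    (S : Finset (Finset (Fin n)))
    (hS : ∀ s, s ∈ S ↔ s ∈ T ∧ ∃ p ∈ convexHull ℝ (x '' s), p ∉ nearBoundary K (volume[|K]) η r)
    (e : Finset (Fin n) → Fin 2)
    (he : ∀ s ∈ S, ∀ q ∈ convexHull ℝ (x '' s), plugin η q = e s) :
    ∑ s ∈ S, (∑ j ∈ s, labelWeight η (x j) (otherLabel (e s))) *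
        (volume[|K]) (convexHull ℝ (x '' s)) ≤
      (d + 1) * (∫⁻ p, labelWeight η p (otherLabel (plugin η p)) ∂volume[|K] +
        ENNReal.ofReal (L * (4 * r)) + (volume[|K]) (nearBoundary K (volume[|K]) η r)) := by
  have := isProbabilityMeasure_cond_of_isCompact hK hint
  set μ := volume[|K] with hμ
  set B := toMeasurable μ (nearBoundary K μ η r)
  have hBm : MeasurableSet B := measurableSet_toMeasurable _ _
  have hsupp : μ.support = K := support_cond_eq hK hconv hint
  -- A simplex of `S` may also contain points near the boundary. At those the trivial bound one is
  -- used, on a measurable hull `B`.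
  let φ : E d → ℝ≥0∞ := fun p => labelWeight η p (otherLabel (plugin η p)) +
    ENNReal.ofReal (L * (4 * r)) + B.indicator 1 p
  have hwm : Measurable fun p => labelWeight η p (otherLabel (plugin η p)) := by
    simp_rw [labelWeight_otherLabel_plugin]
    refine Measurable.ennreal_ofReal ?_
    unfold bayesError
    exact Measurable.ite (measurable_plugin hη (measurableSet_singleton 1))
      (measurable_const.sub hη) hη
  have hφ : ∫⁻ p, φ p ∂μ = ∫⁻ p, labelWeight η p (otherLabel (plugin η p)) ∂μ +
      ENNReal.ofReal (L * (4 * r)) + μ (nearBoundary K μ η r) := by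
    simp only [φ]
    rw [lintegral_add_right _ (measurable_one.indicator hBm), lintegral_add_right _ measurable_const,
      lintegral_indicator_one hBm, measure_toMeasurable]
    simp
  have hvert : ∀ s ∈ S, ∀ j ∈ s, ∀ p ∈ convexHull ℝ (x '' s),
      labelWeight η (x j) (otherLabel (e s)) ≤ φ p := by
    intro s hs j hj p hp
    have hjs : x j ∈ convexHull ℝ (x '' s) := subset_convexHull ℝ _ ⟨j, hj, rfl⟩
    have hej : plugin η (x j) = e s := he s hs _ hjs
    have hxs : x j ∈ μ.support := hsupp ▸ hxK j
    rw [← hej, labelWeight_otherLabel_plugin]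
    by_cases hpB : p ∈ B
    · refine le_trans ?_ le_add_self
      rw [indicator_of_mem hpB, Pi.one_apply]
      refine ENNReal.ofReal_le_one.2 ?_
      linarith [hm.bayesError_le hxs, hm.1]
    · refine le_trans ?_ le_self_add
      have hpn : p ∉ nearBoundary K μ η r := fun hcon => hpB (subset_toMeasurable _ _ hcon)
      obtain ⟨h1, h2⟩ := hT.near_of_notMem_nearBoundary hK hconv hint hxK hx hr ((hS s).1 hs).1
        hp hpn hjs
      rw [labelWeight_otherLabel_plugin]
      refine (ENNReal.ofReal_le_ofReal (bayesError_le_add hm hL0 hL1 ?_ hxs h1 h2)).trans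
        ENNReal.ofReal_add_le
      rw [hsupp]
      exact convexHull_simplex_subset hconv hxK s hp
  have hcm : ∀ s : Finset (Fin n), MeasurableSet (convexHull ℝ (x '' s)) := fun s =>
    ((s.finite_toSet.image x).isCompact_convexHull ℝ).isClosed.measurableSet
  calc _ ≤ ∑ s ∈ S, (d + 1) * ∫⁻ p in convexHull ℝ (x '' s), φ p ∂μ := by
        refine Finset.sum_le_sum fun s hs => ?_
        rw [Finset.sum_mul]
        refine (Finset.sum_le_card_nsmul _ _
          (∫⁻ p in convexHull ℝ (x '' s), φ p ∂μ) fun j hj => ?_).trans (le_of_eq ?_)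
        · rw [← setLIntegral_const]
          exact setLIntegral_mono' (hcm s) (hvert s hs j hj)
        · rw [hT.card_eq s ((hS s).1 hs).1]
          simp
    _ ≤ _ := by
        rw [← Finset.mul_sum, ← hφ]
        gcongr
        exact hT.sum_lintegral_le S (fun s hs => ((hS s).1 hs).1) φ

theorem sum_risk_le {P : Measure (E d × Fin 2)} [IsProbabilityMeasure P] (hP : P.fst = volume[|K])
    (hηP : IsConditionalMean P η) (𝒯 : TriangulationScheme d)
    (hT : IsDelaunayTriangulation x (𝒯 n x)) (hK : IsCompact K)
    (hconv : Convex ℝ K) (hint : (interior K).Nonempty) (hxK : ∀ i, x i ∈ K)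
    (hx01 : ∀ i, η (x i) ∈ Icc (0 : ℝ) 1) (hx : IsNet K r x) (hr : 0 < r)
    {h : ℝ} (hh : h ≤ 1 / 2) (hm : HardMargin (volume[|K]) η h) {L : ℝ≥0}
    (hL0 : LipschitzOnWith L η {x | x ∈ (volume[|K]).support ∧ η x < 1 / 2})
    (hL1 : LipschitzOnWith L η {x | x ∈ (volume[|K]).support ∧ 1 / 2 < η x}) :
    ∑ y : Fin n → Fin 2, risk P (simplicialClassifier 𝒯 fun i => (x i, y i)) *
        ∏ i, labelWeight η (x i) (y i) ≤
      risk P (plugin η) + P.fst (nearBoundary K P.fst η r) +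
        excessFactor d h * (risk P (plugin η) + ENNReal.ofReal (L * (4 * r)) +
          P.fst (nearBoundary K P.fst η r)) := by
  classical
  have hsupp : (volume[|K]).support = K := support_cond_eq hK hconv hint
  let S : Finset (Finset (Fin n)) := Finset.univ.filter fun s =>
    s ∈ 𝒯 n x ∧ ∃ p ∈ convexHull ℝ (x '' s), p ∉ nearBoundary K (volume[|K]) η r
  have hS : ∀ s, s ∈ S ↔
      s ∈ 𝒯 n x ∧ ∃ p ∈ convexHull ℝ (x '' s), p ∉ nearBoundary K (volume[|K]) η r := fun s => by
    simp [S]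
  have hex : ∀ s, ∃ e : Fin 2, s ∈ S → ∀ q ∈ convexHull ℝ (x '' s), plugin η q = e := by
    intro s
    by_cases hs : s ∈ S
    · obtain ⟨hsT, p, hp, hpb⟩ := (hS s).1 hs
      exact ⟨plugin η p, fun _ q hq =>
        (hT.near_of_notMem_nearBoundary hK hconv hint hxK hx hr hsT hp hpb hq).1⟩
    · exact ⟨0, fun h => absurd h hs⟩
  choose e he using hex
  have hsumw : ∀ i, ∑ y, labelWeight η (x i) y = 1 := fun i => sum_labelWeight (hx01 i)
  have hone : ∑ y : Fin n → Fin 2, ∏ i, labelWeight η (x i) (y i) = 1 := by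
    have : ∏ i, ∑ b, labelWeight η (x i) b = 1 := Finset.prod_eq_one fun i _ => hsumw i
    rwa [Finset.prod_univ_sum, Fintype.piFinset_univ] at this
  have hh0 := hm.1
  set ν := (volume[|K]) (nearBoundary K (volume[|K]) η r)
  have hrisk : ∀ y : Fin n → Fin 2, risk P (simplicialClassifier 𝒯 fun i => (x i, y i)) ≤
      (risk P (plugin η) + ν) + ∑ s ∈ S, (∑ j ∈ s, (if y j = otherLabel (e s) then 1 else 0) *
          ∏ i ∈ s, labelFactor h (otherLabel (e s)) (y i)) * (volume[|K]) (convexHull ℝ (x '' s)) := by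
    intro y
    refine (risk_le_risk_add P _ (plugin η)).trans ?_
    rw [hP, add_assoc]
    gcongr
    exact cond_disagreement_le hT hK hconv hxK hx hr hh0.le (by linarith) S hS e he y
  have hsimplex : ∀ s ∈ S, ∑ y : Fin n → Fin 2, (∑ j ∈ s, (if y j = otherLabel (e s) then 1 else 0) *
      ∏ i ∈ s, labelFactor h (otherLabel (e s)) (y i)) * ∏ i, labelWeight η (x i) (y i) ≤
      (∑ j ∈ s, labelWeight η (x j) (otherLabel (e s))) *
        (ENNReal.ofReal (1 - h)⁻¹ * ENNReal.ofReal (chernoffRate h) ^ d) := by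
    intro s hs
    refine (sum_labels_chernoff_le (fun i => labelWeight η (x i)) hsumw s
      (labelFactor h (otherLabel (e s))) (otherLabel (e s)) (ρ := ENNReal.ofReal (chernoffRate h))
      fun i hi => ?_).trans (le_of_eq ?_)
    · rw [← he s hs _ (subset_convexHull ℝ _ ⟨i, hi, rfl⟩)]
      exact hm.sum_labelWeight_mul_labelFactor_le hh (hsupp.symm.subset (hxK i)) (hx01 i)
    · rw [hT.card_eq s ((hS s).1 hs).1, Finset.sum_mul]
      simp [labelFactor, mul_assoc]
  have hR : ∫⁻ p, labelWeight η p (otherLabel (plugin η p)) ∂volume[|K] ≤ risk P (plugin η) := by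
    rw [← hP]; exact hηP.lintegral_le_risk
  rw [hP]
  calc _ ≤ ∑ y : Fin n → Fin 2, ((risk P (plugin η) + ν) + ∑ s ∈ S, (∑ j ∈ s,
          (if y j = otherLabel (e s) then 1 else 0) * ∏ i ∈ s, labelFactor h (otherLabel (e s)) (y i)) *
            (volume[|K]) (convexHull ℝ (x '' s))) * ∏ i, labelWeight η (x i) (y i) := by
        gcongr with y
        exact hrisk y
    _ = (risk P (plugin η) + ν) + ∑ s ∈ S, (∑ y : Fin n → Fin 2, (∑ j ∈ s,
          (if y j = otherLabel (e s) then 1 else 0) * ∏ i ∈ s, labelFactor h (otherLabel (e s)) (y i)) *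
            ∏ i, labelWeight η (x i) (y i)) * (volume[|K]) (convexHull ℝ (x '' s)) := by
        simp_rw [add_mul _ (∑ s ∈ S, _)]
        rw [Finset.sum_add_distrib, ← Finset.mul_sum, hone, mul_one]
        congr 1
        simp_rw [Finset.sum_mul _ _ (∏ i, labelWeight η (x i) _)]
        rw [Finset.sum_comm]
        refine Finset.sum_congr rfl fun s _ => ?_
        rw [Finset.sum_mul]
        refine Finset.sum_congr rfl fun y _ => ?_
        rw [mul_right_comm, Finset.sum_mul _ _ (∏ i, labelWeight η (x i) (y i))]
    _ ≤ (risk P (plugin η) + ν) + ∑ s ∈ S, ((∑ j ∈ s, labelWeight η (x j) (otherLabel (e s))) *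
        (ENNReal.ofReal (1 - h)⁻¹ * ENNReal.ofReal (chernoffRate h) ^ d)) *
          (volume[|K]) (convexHull ℝ (x '' s)) := by
        gcongr with s hs
        exact hsimplex s hs
    _ = (risk P (plugin η) + ν) + (ENNReal.ofReal (1 - h)⁻¹ * ENNReal.ofReal (chernoffRate h) ^ d) *
        ∑ s ∈ S, (∑ j ∈ s, labelWeight η (x j) (otherLabel (e s))) *
          (volume[|K]) (convexHull ℝ (x '' s)) := by
        rw [Finset.mul_sum]
        congr 1
        exact Finset.sum_congr rfl fun s _ => by ring
    _ ≤ (risk P (plugin η) + ν) + (ENNReal.ofReal (1 - h)⁻¹ * ENNReal.ofReal (chernoffRate h) ^ d) *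
        ((d + 1) * (risk P (plugin η) + ENNReal.ofReal (L * (4 * r)) + ν)) := by
        gcongr
        refine (sum_simplex_error_le hT hK hconv hint hxK hηP.1 hx hr hm hL0 hL1 S hS e
          he).trans ?_
        gcongr
    _ = _ := by
        rw [excessFactor]
        ring

end FixedSample

/-! ### The expected risk -/

theorem expectedRisk_le {d : ℕ} {K : Set (E d)} {η : E d → ℝ} {r : ℝ}
    {P : Measure (E d × Fin 2)} [IsProbabilityMeasure P] (hP : P.fst = volume[|K])
    (hηP : IsConditionalMean P η) (𝒯 : TriangulationScheme d) (h𝒯 : 𝒯.IsDelaunay)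
    (hK : IsCompact K) (hconv : Convex ℝ K) (hr : 0 < r) {p₀ : E d}
    (hp₀ : Metric.closedBall p₀ (3 * r) ⊆ K)
    {h : ℝ} (hh : h ≤ 1 / 2) (hm : HardMargin P.fst η h) {L : ℝ≥0}
    (hL0 : LipschitzOnWith L η {x | x ∈ P.fst.support ∧ η x < 1 / 2})
    (hL1 : LipschitzOnWith L η {x | x ∈ P.fst.support ∧ 1 / 2 < η x}) (n : ℕ) :
    expectedRisk P 𝒯 n ≤
      risk P (plugin η) + P.fst (nearBoundary K P.fst η r) +
        excessFactor d h * (risk P (plugin η) + ENNReal.ofReal (L * (4 * r)) +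
          P.fst (nearBoundary K P.fst η r)) +
        (Measure.pi fun _ : Fin n => volume[|K]) {x | ¬ IsNet K r x} := by
  have hint : (interior K).Nonempty := ⟨p₀, interior_mono hp₀
    (Metric.ball_subset_interior_closedBall (Metric.mem_ball_self (by positivity)))⟩
  have := isProbabilityMeasure_cond_of_isCompact hK hint
  set C := risk P (plugin η) + P.fst (nearBoundary K P.fst η r) +
        excessFactor d h * (risk P (plugin η) + ENNReal.ofReal (L * (4 * r)) +
          P.fst (nearBoundary K P.fst η r)) with hC
  set N := toMeasurable (Measure.pi fun _ : Fin n => volume[|K]) {x | ¬ IsNet K r x}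
  have hNm : MeasurableSet N := measurableSet_toMeasurable _ _
  refine (lintegral_pi_le_lintegral_sum hηP.measure_eq (measurable_labelWeight hηP.1) n _).trans ?_
  rw [hP]
  have hae : ∀ᵐ x ∂(Measure.pi fun _ : Fin n => volume[|K]),
      ∀ i, x i ∈ K ∧ η (x i) ∈ Icc (0 : ℝ) 1 := by
    rw [ae_all_iff]
    intro i
    have h1 : ∀ᵐ p ∂(volume[|K]), p ∈ K ∧ η p ∈ Icc (0 : ℝ) 1 := by
      have h2 := hηP.ae_mem_Icc
      rw [hP] at h2
      filter_upwards [ae_cond_mem hK.measurableSet, h2] with p hp hp'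
      exact ⟨hp, hp'⟩
    exact (Measure.quasiMeasurePreserving_eval (fun _ : Fin n => volume[|K]) i).ae h1
  calc _ ≤ ∫⁻ x, (C + N.indicator 1 x) ∂(Measure.pi fun _ : Fin n => volume[|K]) := by
        refine lintegral_mono_ae ?_
        filter_upwards [hae] with x hx
        -- Off the nets the risk is bounded by one and the label weights sum to one, which costs the
        -- probability of not being a net.
        by_cases hxN : x ∈ N
        · refine le_trans ?_ le_add_self
          rw [indicator_of_mem hxN, Pi.one_apply]
          have hone : ∏ i, ∑ b, labelWeight η (x i) b = 1 :=
            Finset.prod_eq_one fun i _ => sum_labelWeight (hx i).2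
          rw [Finset.prod_univ_sum, Fintype.piFinset_univ] at hone
          rw [← hone]
          gcongr with y
          exact mul_le_of_le_one_left zero_le prob_le_one
        · refine le_trans ?_ le_self_add
          have hnet : IsNet K r x := by
            by_contra hcon
            exact hxN (subset_toMeasurable _ _ hcon)
          have hT := h𝒯 n x (hnet.affineSpan_eq_top hr hp₀)
          rw [hP] at hm hL0 hL1
          exact sum_risk_le hP hηP 𝒯 hT hK hconv hint (fun i => (hx i).1) (fun i => (hx i).2) hnet
            hr hh hm hL0 hL1
    _ = _ := by
        rw [lintegral_add_left measurable_const, lintegral_indicator_one hNm, measure_toMeasurable]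
        simp

theorem limsup_expectedRisk_le {d : ℕ} {K : Set (E d)} {η : E d → ℝ}
    {P : Measure (E d × Fin 2)} [IsProbabilityMeasure P] (hP : P.fst = volume[|K])
    (hηP : IsConditionalMean P η) (𝒯 : TriangulationScheme d) (h𝒯 : 𝒯.IsDelaunay)
    (hK : IsCompact K) (hconv : Convex ℝ K) (hint : (interior K).Nonempty)
    {h : ℝ} (hh : h ≤ 1 / 2) (hm : HardMargin P.fst η h) (hL : LipschitzAwayFromBoundary P.fst η)
    (hvan : VanishingBoundary P.fst η) :
    limsup (fun n => expectedRisk P 𝒯 n) atTop ≤ risk P (plugin η) * (1 + excessFactor d h) := by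
  obtain ⟨L, hL0, hL1⟩ := hL
  have hexc : excessFactor d h ≠ ∞ := by
    unfold excessFactor
    finiteness
  let b : ℝ → ℝ≥0∞ := fun r => risk P (plugin η) + P.fst (nearBoundary K P.fst η r) +
        excessFactor d h * (risk P (plugin η) + ENNReal.ofReal (L * (4 * r)) +
          P.fst (nearBoundary K P.fst η r))
  obtain ⟨p₀, hp₀⟩ := hint
  obtain ⟨ε, hε, hball⟩ := Metric.mem_nhds_iff.1 (mem_interior_iff_mem_nhds.1 hp₀)
  -- First `n → ∞` with `r` fixed; the left side does not depend on `r`, which is then sent to zero.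
  have hle : ∀ r ∈ Ioo (0 : ℝ) (ε / 3), limsup (fun n => expectedRisk P 𝒯 n) atTop ≤ b r := by
    rintro r ⟨hr, hrε⟩
    have hp₀r : Metric.closedBall p₀ (3 * r) ⊆ K :=
      (Metric.closedBall_subset_ball (by linarith)).trans hball
    have hlim := (tendsto_measure_not_isNet hK ⟨p₀, hp₀⟩ hr).const_add (b r)
    rw [add_zero] at hlim
    rw [← hlim.limsup_eq]
    exact limsup_le_limsup (Eventually.of_forall fun n =>
      expectedRisk_le hP hηP 𝒯 h𝒯 hK hconv hr hp₀r hh hm hL0 hL1 n)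
  have hmul : ∀ c : ℝ, 0 < c → Tendsto (fun r : ℝ => c * r) (𝓝[>] 0) (𝓝[>] 0) := by
    intro c hc
    refine tendsto_nhdsWithin_iff.2 ⟨?_, ?_⟩
    · refine Tendsto.mono_left ?_ nhdsWithin_le_nhds
      have : Tendsto (fun r : ℝ => c * r) (𝓝 0) (𝓝 (c * 0)) := by
        exact (continuous_const.mul continuous_id).tendsto 0
      rwa [mul_zero] at this
    · filter_upwards [self_mem_nhdsWithin] with r hr
      exact mul_pos hc hr
  have hnear : Tendsto (fun r => P.fst (nearBoundary K P.fst η r)) (𝓝[>] 0) (𝓝 0) := by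
    have h1 := (tendsto_measure_near_frontier hK hconv ⟨p₀, hp₀⟩).comp
      ((hmul 2 two_pos).mono_right nhdsWithin_le_nhds)
    have h2 := Tendsto.comp hvan (hmul 4 four_pos)
    rw [← hP] at h1
    have h3 := h1.add h2
    rw [add_zero] at h3
    exact tendsto_of_tendsto_of_tendsto_of_le_of_le tendsto_const_nhds h3 (fun _ => zero_le)
      fun r => measure_union_le _ _
  have hLr : Tendsto (fun r : ℝ => ENNReal.ofReal (L * (4 * r))) (𝓝[>] 0) (𝓝 0) := by
    have h1 : Tendsto (fun r : ℝ => L * (4 * r)) (𝓝[>] 0) (𝓝 (L * 0)) :=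
      ((hmul 4 four_pos).mono_right nhdsWithin_le_nhds).const_mul (L : ℝ)
    have h2 := ENNReal.tendsto_ofReal h1
    rwa [mul_zero, ENNReal.ofReal_zero] at h2
  have hb : Tendsto b (𝓝[>] 0) (𝓝 (risk P (plugin η) + 0 +
      excessFactor d h * (risk P (plugin η) + 0 + 0))) :=
    (hnear.const_add _).add (ENNReal.Tendsto.const_mul ((hLr.const_add _).add hnear) (Or.inr hexc))
  have hfin := ge_of_tendsto hb (by
    filter_upwards [Ioo_mem_nhdsGT (show (0 : ℝ) < ε / 3 by positivity)] with r hr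
    exact hle r hr)
  refine hfin.trans (le_of_eq ?_)
  ring

theorem exists_excessFactor_le {h : ℝ} (hh0 : 0 < h) (hh : h ≤ 1 / 2) :
    ∃ c₁ c₂ : ℝ, 0 < c₁ ∧ 0 < c₂ ∧
      ∀ d : ℕ, excessFactor d h ≤ ENNReal.ofReal (c₁ * Real.exp (-c₂ * d)) := by
  have hden : 0 < 1 - h ^ 2 := by nlinarith
  have hρ0 : 0 < chernoffRate h := div_pos (by nlinarith) hden
  have hρ1 : chernoffRate h < 1 := by
    rw [chernoffRate, div_lt_one hden]
    nlinarith [sq_pos_of_pos hh0]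
  have hlog := Real.log_neg hρ0 hρ1
  -- Half of the available rate: one factor `exp (-c * d)` absorbs `d + 1`, the other remains.
  set c : ℝ := -Real.log (chernoffRate h) / 2 with hc
  have hc0 : 0 < c := by linarith
  have h1h : 0 < 1 - h := by linarith
  refine ⟨(1 + c⁻¹) * (1 - h)⁻¹, c, by positivity, hc0, fun d => ?_⟩
  have hpow : chernoffRate h ^ d = Real.exp (-c * d) * Real.exp (-c * d) := by
    rw [← Real.exp_add, ← Real.exp_log hρ0, ← Real.exp_nat_mul]
    congr 1
    rw [hc]
    ring
  have hlin : (d + 1) * Real.exp (-c * d) ≤ 1 + c⁻¹ := by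
    have h1 := Real.add_one_le_exp (c * d)
    have h2 : (d : ℝ) + 1 ≤ (1 + c⁻¹) * Real.exp (c * d) := by
      have h3 : (1 + c⁻¹) * (c * d + 1) ≤ (1 + c⁻¹) * Real.exp (c * d) := by gcongr
      have h4 : (1 + c⁻¹) * (c * d + 1) = c * d + 1 + d + c⁻¹ := by field_simp; ring
      have : 0 ≤ c * d := by positivity
      have : 0 < c⁻¹ := by positivity
      linarith
    calc (d + 1) * Real.exp (-c * d) ≤ (1 + c⁻¹) * Real.exp (c * d) * Real.exp (-c * d) := by gcongr
      _ = 1 + c⁻¹ := by rw [mul_assoc, ← Real.exp_add]; simp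
  have hcast : ((d : ℝ≥0∞) + 1) = ENNReal.ofReal (d + 1) := by
    rw [ENNReal.ofReal_add (by positivity) zero_le_one]; simp
  rw [excessFactor, hcast, ← ENNReal.ofReal_pow hρ0.le, ← ENNReal.ofReal_mul (by positivity),
    ← ENNReal.ofReal_mul (by positivity)]
  refine ENNReal.ofReal_le_ofReal ?_
  rw [hpow]
  calc ((d : ℝ) + 1) * ((1 - h)⁻¹ * (Real.exp (-c * d) * Real.exp (-c * d)))
      = ((d + 1) * Real.exp (-c * d)) * ((1 - h)⁻¹ * Real.exp (-c * d)) := by ring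
    _ ≤ (1 + c⁻¹) * ((1 - h)⁻¹ * Real.exp (-c * d)) := by gcongr
    _ = _ := by ring

end SimplicialInterpolation

end

open SimplicialInterpolation in
theorem mainTheorem5 (h : ℝ) (hh : 0 < h) :
    ∃ c₁ c₂ : ℝ, 0 < c₁ ∧ 0 < c₂ ∧
      ∀ (d : ℕ), 1 ≤ d →
      ∀ (K : Set (E d)), IsSimplePolytope K →
      ∀ (P : Measure (E d × Fin 2)), IsProbabilityMeasure P → P.fst = volume[|K] →
      ∀ (η : E d → ℝ), IsConditionalMean P η →
        HardMargin P.fst η h →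
        LipschitzAwayFromBoundary P.fst η →
        VanishingBoundary P.fst η →
      ∀ (T : TriangulationScheme d), T.IsDelaunay →
        limsup (fun n : ℕ => expectedRisk P T n) atTop
          ≤ risk P (plugin η) * ENNReal.ofReal (1 + c₁ * Real.exp (-c₂ * d)) := by
  -- Lowering the margin to at most `1 / 2` preserves the margin condition and keeps the tilt below
  -- one and the Chernoff rate in `(0, 1)`.
  have hmin0 : 0 < min h (1 / 2) := lt_min hh (by norm_num)
  obtain ⟨c₁, c₂, hc₁, hc₂, hle⟩ := exists_excessFactor_le hmin0 (min_le_right _ _)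
  refine ⟨c₁, c₂, hc₁, hc₂, ?_⟩
  intro d _ K hK P hPprob hP η hη hm hL hvan T hT
  obtain ⟨V, hV, rfl⟩ := hK.polytope
  have hm' : HardMargin P.fst η (min h (1 / 2)) :=
    ⟨hmin0, fun x hx => (min_le_left _ _).trans (hm.2 x hx)⟩
  refine (limsup_expectedRisk_le hP hη T hT (hV.isCompact_convexHull ℝ) (convex_convexHull ℝ V)
    hK.fullDim (min_le_right _ _) hm' hL hvan).trans ?_
  rw [ENNReal.ofReal_add zero_le_one (by positivity), ENNReal.ofReal_one]
  gcongr
  exact hle d
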